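/- Fix the number of predictors $p$ and the number of components $d$. For each sample size $n$ let $(\mathbf X,\mathbf Y)\in\mathbb R^p\times\mathbb R^{r}$, $r=r_n$, be a mean zero random vector following the linear model $\mathbf Y=\boldsymbol\alpha+\boldsymbol\beta\mathbf X+\boldsymbol\varepsilon$ with $\boldsymbol\varepsilon$ independent of $\mathbf X$, and suppose that $P(|\mathbf w^{T}(\mathbf X^T,\mathbf Y^T)^T|\ge t)\le 2\exp(-t^2/\sigma^2)$ for all unit vectors $\mathbf w\in\mathbb R^{p+r}$ and all $t\ge 0$, where $\sigma>0$ does not depend on $n$. Put $\mathbf M=\boldsymbol\Sigma_{\mathbf Y}$ and $\mathbf U=\boldsymbol\Sigma_{\mathbf{YX}}\boldsymbol\Sigma_{\mathbf{XY}}$, let $\lambda_1\ge\lambda_2\ge\dots\ge\lambda_r$ be the eigenvalues of $\mathbf M$ (with $\lambda_{r+1}:=0$), and let $\mathbf v_1,\dots,\mathbf v_d$ be orthonormal eigenvectors of $\mathbf M$ for $\lambda_1,\dots,\lambda_d$. Let $\mathcal E$ be the response envelope, that is, the intersection of all reducing subspaces of $\mathbf M$ that contain $\mathrm{span}(\boldsymbol\Sigma_{\mathbf{YX}})$;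 here a subspace $\mathcal R$ with orthogonal projection $\mathbf P$ is reducing if $\mathbf M=\mathbf P\mathbf M\mathbf P+(\mathbf I-\mathbf P)\mathbf M(\mathbf I-\mathbf P)$. Assume that $\mathcal E\subseteq\mathrm{span}(\mathbf v_1,\dots,\mathbf v_d)$, that $u=\dim\mathcal E\ge 1$, and that $\min_{1\le j\le d}(\lambda_j-\lambda_{j+1})\ge\delta$ for some $\delta>0$ not depending on $n$. Let $\Delta_{\mathbf U}=\phi_{(u)}-\phi_{(u+1)}$, where $\phi_{(1)}\ge\dots\ge\phi_{(d)}$ are the sorted envelope scores $\phi_j=\mathbf v_j^{T}\mathbf U\mathbf v_j$ and $\phi_{(d+1)}:=0$. Let $(\mathbf X_i,\mathbf Y_i)$, $i=1,\dots,n$, be i.i.d. copies of $(\mathbf X,\mathbf Y)$. The sparse NIECE estimator $\widehat{\mathcal E}$ with known $u$ and tuning parameter $\tau=\tau_n>\max_{1\le k\le d}\|\mathbf v_k\|_1$ is defined as follows. Let $\mathbf D^1$ be $n^{-1/2}$ times the $n\times r$ matrix with rows $\mathbf Y_i^T$. For $k=1,\dots,d$ let $(\widehat{\mathbf u}_k,\widehat{\mathbf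 v}_k)$ maximize $\mathbf a^{T}\mathbf D^k\mathbf v$ over $\mathbf a\in\mathbb R^n$, $\mathbf v\in\mathbb R^r$ with $\|\mathbf v\|_1\le\tau$, $\|\mathbf v\|_2\le1$, $\|\mathbf a\|_2\le1$, and put $\mathbf D^{k+1}=\mathbf D^k-(\widehat{\mathbf u}_k^{T}\mathbf D^k\widehat{\mathbf v}_k)\,\widehat{\mathbf u}_k\widehat{\mathbf v}_k^{T}$. With $\widehat{\boldsymbol\Sigma}_{\mathbf{YX}}=n^{-1}\sum_i\mathbf Y_i\mathbf X_i^T=\widehat{\boldsymbol\Sigma}_{\mathbf{XY}}^T$ and $\widehat{\mathbf U}=\widehat{\boldsymbol\Sigma}_{\mathbf{YX}}\widehat{\boldsymbol\Sigma}_{\mathbf{XY}}$, let $\widehat{\mathcal E}$ be the span of the $u$ vectors $\widehat{\mathbf v}_k$ with the largest estimated scores $\widehat{\mathbf v}_k^{T}\widehat{\mathbf U}\widehat{\mathbf v}_k$. Maximizers and ties may be chosen arbitrarily. If $r\to\infty$, $\log r=o(n)$ and $$\max\left(\tau^2\sqrt{\log r},\ \Delta_{\mathbf U}^{-2}\tau^2\sqrt{\log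 r}\right)=o(\sqrt n)$$ as $n\to\infty$, then $\|\mathbf P_{\widehat{\mathcal E}}-\mathbf P_{\mathcal E}\|_F\to0$ in probability, where $\mathbf P$ denotes the orthogonal projection matrix onto the indicated subspace and $\|\cdot\|_F$ the Frobenius norm. -/

import Mathlib

open MeasureTheory ProbabilityTheory Filter Topology Matrix Asymptotics

noncomputable section

namespace SparseNIECE

/-- Real `k`-vectors with the Euclidean norm. -/
abbrev Vec (k : ℕ) := EuclideanSpace ℝ (Fin k)

/-! ### Linear algebra -/

/-- The `ℓ₁` norm `∑ᵢ |vᵢ|`. -/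
def l1Norm {k : ℕ} (v : Vec k) : ℝ := ∑ i, |v i|

/-- The quadratic form `vᵀ A v`. -/
def quadForm {k : ℕ} (A : Matrix (Fin k) (Fin k) ℝ) (v : Vec k) : ℝ :=
  v.ofLp ⬝ᵥ (A *ᵥ v.ofLp)

/-- The Frobenius norm `√(∑ᵢⱼ aᵢⱼ²)`. -/
def frobNorm {k l : ℕ} (A : Matrix (Fin k) (Fin l) ℝ) : ℝ := √(∑ i, ∑ j, A i j ^ 2)

/-- The matrix of the orthogonal projection onto a subspace `R` of `ℝᵏ`. -/
def projMatrix {k : ℕ} (R : Submodule ℝ (Vec k)) : Matrix (Fin k) (Fin k) ℝ :=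
  Matrix.toEuclideanLin.symm (R.starProjection : Vec k →ₗ[ℝ] Vec k)

/-- The column space of a matrix. -/
def colSpan {k l : ℕ} (B : Matrix (Fin k) (Fin l) ℝ) : Submodule ℝ (Vec k) :=
  LinearMap.range (Matrix.toEuclideanLin B)

/-- `λ_{j+1}(M)`, the eigenvalues of the symmetric matrix `M` counted with multiplicity in
decreasing order and numbered from `j = 0`; set to `0` beyond the size of the matrix. -/
def eigval {k : ℕ} (M : Matrix (Fin k) (Fin k) ℝ) (j : ℕ) : ℝ :=
  open Classical in
  if h : M.IsHermitian ∧ j < k then h.1.eigenvalues₀ ⟨j, by simpa using h.2⟩ else 0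

/-- `v₁, …, v_d` are orthonormal eigenvectors of `M` for its `d` largest eigenvalues. -/
structure IsLeadingEigenvectors {k d : ℕ} (M : Matrix (Fin k) (Fin k) ℝ)
    (v : Fin d → Vec k) : Prop where
  orthonormal : Orthonormal ℝ v
  eigen : ∀ j, M *ᵥ (v j).ofLp = eigval M j • (v j).ofLp

/-- The minimal eigen-gap `Δ = min_{1 ≤ j ≤ d} (λ_j(M) - λ_{j+1}(M))`. -/
def eigenGap {k : ℕ} (M : Matrix (Fin k) (Fin k) ℝ) (d : ℕ) : ℝ :=
  ⨅ j : Fin d, (eigval M j - eigval M (j + 1))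

/-! ### Envelopes -/

/-- `R` is a reducing subspace of `M`: `M = P M P + Q M Q`, where `P` is the projection onto `R`
and `Q = I - P`. -/
def IsReducing {k : ℕ} (M : Matrix (Fin k) (Fin k) ℝ) (R : Submodule ℝ (Vec k)) : Prop :=
  M = projMatrix R * M * projMatrix R + (1 - projMatrix R) * M * (1 - projMatrix R)

/-- The `M`-envelope of `span B`: the intersection of all reducing subspaces of `M` that
contain the column space of `B`. -/
def envelope {k l : ℕ} (M : Matrix (Fin k) (Fin k) ℝ) (B : Matrix (Fin k) (Fin l) ℝ) :
    Submodule ℝ (Vec k) :=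
  sInf {R | IsReducing M R ∧ colSpan B ≤ R}

/-- The order statistic `φ_{(j+1)}` of `φ₁, …, φ_d` in decreasing order, numbered from `j = 0`;
set to `0` for `j ≥ d`. -/
def sortedDesc {d : ℕ} (φ : Fin d → ℝ) (j : ℕ) : ℝ :=
  if h : j < d then φ (Tuple.sort (fun i => -φ i) ⟨j, h⟩) else 0

/-- The envelope score gap `Δ_U = φ_{(u)} - φ_{(u+1)}` of the envelope scores
`φ_j = v_jᵀ U v_j`. -/
def scoreGap {k d : ℕ} (U : Matrix (Fin k) (Fin k) ℝ) (v : Fin d → Vec k) (u : ℕ) : ℝ :=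
  sortedDesc (fun j => quadForm U (v j)) (u - 1) - sortedDesc (fun j => quadForm U (v j)) u

/-! ### The population -/

section Population

variable {Ω : Type*} [MeasurableSpace Ω] {p r : ℕ}

/-- The (cross-)covariance matrix `cov(V, W)` of two random vectors. -/
def covMatrix {k l : ℕ} (μ : Measure Ω) (V : Ω → Vec k) (W : Ω → Vec l) :
    Matrix (Fin k) (Fin l) ℝ :=
  Matrix.of fun i j => cov[fun ω => V ω i, fun ω => W ω j; μ]

theorem covMatrix_self_isHermitian {k : ℕ} (μ : Measure Ω) (V : Ω → Vec k) :
    (covMatrix μ V V).IsHermitian := by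
  ext i j
  simp [covMatrix, covariance_comm]

/-- The multivariate linear model `Y = α + β X + ε` with `ε` independent of `X`. -/
def IsLinearModel (μ : Measure Ω) (X : Ω → Vec p) (Y : Ω → Vec r) : Prop :=
  ∃ (α : Vec r) (β : Matrix (Fin r) (Fin p) ℝ) (ε : Ω → Vec r),
    Measurable ε ∧ IndepFun ε X μ ∧
      ∀ᵐ ω ∂μ, Y ω = α + Matrix.toEuclideanLin β (X ω) + ε ω

/-- Joint sub-Gaussian tails: `P(|wᵀ (X, Y)| ≥ t) ≤ 2 exp(-t² / σ²)` for every unit vector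
`w = (a, b)` of `ℝ^{p+r}` and every `t ≥ 0`. -/
def IsJointSubGaussian (μ : Measure Ω) (X : Ω → Vec p) (Y : Ω → Vec r) (σ : ℝ) : Prop :=
  ∀ (a : Vec p) (b : Vec r), ‖a‖ ^ 2 + ‖b‖ ^ 2 = 1 → ∀ t : ℝ, 0 ≤ t →
    μ.real {ω | t ≤ |a.ofLp ⬝ᵥ (X ω).ofLp + b.ofLp ⬝ᵥ (Y ω).ofLp|} ≤
      2 * Real.exp (-(t ^ 2 / σ ^ 2))

/-- The random vector `V` has mean zero. -/
def HasMeanZero {k : ℕ} (μ : Measure Ω) (V : Ω → Vec k) : Prop :=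
  ∀ i, Integrable (fun ω => V ω i) μ ∧ ∫ ω, V ω i ∂μ = 0

/-- `(X₁, Y₁), …, (X_n, Y_n)` are independent copies of `(X, Y)`. -/
structure IsIIDSample {n : ℕ} (μ : Measure Ω) (X : Ω → Vec p) (Y : Ω → Vec r)
    (Xs : Fin n → Ω → Vec p) (Ys : Fin n → Ω → Vec r) : Prop where
  indep : iIndepFun (fun i ω => (Xs i ω, Ys i ω)) μ
  ident : ∀ i, IdentDistrib (fun ω => (Xs i ω, Ys i ω)) (fun ω => (X ω, Y ω)) μ μ

/-- The matrix `M = Σ_Y`. -/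
def popM (μ : Measure Ω) (Y : Ω → Vec r) : Matrix (Fin r) (Fin r) ℝ := covMatrix μ Y Y

/-- The matrix `U = Σ_YX Σ_XY`. -/
def popU (μ : Measure Ω) (X : Ω → Vec p) (Y : Ω → Vec r) : Matrix (Fin r) (Fin r) ℝ :=
  covMatrix μ Y X * covMatrix μ X Y

/-- The response envelope: the `Σ_Y`-envelope of `span Σ_YX`. -/
def responseEnvelope (μ : Measure Ω) (X : Ω → Vec p) (Y : Ω → Vec r) : Submodule ℝ (Vec r) :=
  envelope (popM μ Y) (covMatrix μ Y X)

end Population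

/-! ### The sparse NIECE estimator -/

/-- The `n × k` data matrix whose rows are the given vectors. -/
def dataMatrix {n k : ℕ} (x : Fin n → Vec k) : Matrix (Fin n) (Fin k) ℝ :=
  Matrix.of fun i j => x i j

/-- The sample (cross-)covariance matrix `n⁻¹ ∑ᵢ xᵢ yᵢᵀ` of mean zero data. -/
def sampleCov {n k l : ℕ} (x : Fin n → Vec k) (y : Fin n → Vec l) : Matrix (Fin k) (Fin l) ℝ :=
  (n : ℝ)⁻¹ • ((dataMatrix x)ᵀ * dataMatrix y)

/-- `Û = Σ̂_YX Σ̂_XY`. -/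
def sampleU {n p r : ℕ} (x : Fin n → Vec p) (y : Fin n → Vec r) : Matrix (Fin r) (Fin r) ℝ :=
  sampleCov y x * sampleCov x y

/-- The constraints `‖v‖₁ ≤ τ`, `‖v‖₂² ≤ 1`, `‖a‖₂² ≤ 1` of the penalized matrix decomposition. -/
def PMDFeasible {n k : ℕ} (τ : ℝ) (a : Vec n) (v : Vec k) : Prop :=
  l1Norm v ≤ τ ∧ ‖v‖ ^ 2 ≤ 1 ∧ ‖a‖ ^ 2 ≤ 1

/-- The bilinear form `aᵀ A v`. -/
def bilin {n k : ℕ} (A : Matrix (Fin n) (Fin k) ℝ) (a : Vec n) (v : Vec k) : ℝ :=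
  a.ofLp ⬝ᵥ (A *ᵥ v.ofLp)

/-- `v̂₁, …, v̂_d` are right factors produced by the penalized matrix decomposition of `A`:
at step `k` the pair `(û_k, v̂_k)` maximizes `aᵀ A_k v` under the constraints, and then
`A_{k+1} = A_k - σ̂_k û_k v̂_kᵀ` with `σ̂_k = û_kᵀ A_k v̂_k`, starting from `A`.
Any choice among several maximizers is allowed. -/
def IsPMD {n k d : ℕ} (A : Matrix (Fin n) (Fin k) ℝ) (τ : ℝ) (vhat : Fin d → Vec k) : Prop :=
  ∃ (D : ℕ → Matrix (Fin n) (Fin k) ℝ) (uhat : Fin d → Vec n),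
    D 0 = A ∧
    ∀ j : Fin d,
      PMDFeasible τ (uhat j) (vhat j) ∧
      (∀ a v, PMDFeasible τ a v → bilin (D j) a v ≤ bilin (D j) (uhat j) (vhat j)) ∧
      D (j + 1) = D j -
        bilin (D j) (uhat j) (vhat j) • Matrix.vecMulVec (uhat j).ofLp (vhat j).ofLp

/-- `E` is a sparse NIECE estimate of the response envelope from the data `(xᵢ, yᵢ)`, with `d`
components, envelope dimension `u` and tuning parameter `τ`: the `v̂_j` come from the penalized
matrix decomposition of `n^{-1/2}` times the response data matrix (so that `M̂ = Σ̂_Y`; the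
factor does not affect the `v̂_j`), they are put in decreasing order of the estimated envelope
scores `v̂_jᵀ Û v̂_j`, and `E` is the span of the first `u` of them. -/
def IsSparseNIECE {n p r : ℕ} (x : Fin n → Vec p) (y : Fin n → Vec r) (d u : ℕ) (τ : ℝ)
    (E : Submodule ℝ (Vec r)) : Prop :=
  ∃ (vhat : Fin d → Vec r) (π : Equiv.Perm (Fin d)),
    IsPMD ((√(n : ℝ))⁻¹ • dataMatrix y) τ vhat ∧
    Antitone (fun j => quadForm (sampleU x y) (vhat (π j))) ∧
    E = Submodule.span ℝ ((fun j => vhat (π j)) '' {j : Fin d | (j : ℕ) < u})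

end SparseNIECE

end

/-! The penalized decomposition sees the sample covariance only through quadratic forms at vectors
whose ℓ₁ norm is at most a multiple of τ. There, by Hölder, an entrywise error t of Σ̂_Y changes the
form by O(τ²t), whatever r is. Since D^k v̂_k is a multiple of û_k, one has D^{k+1} = D^k (I - v̂_k
v̂_kᵀ). Hence v̂_k nearly maximizes the population form of M deflated by the earlier v̂_j, the
competitor v_k being feasible because ‖v_k‖₁ < τ. The eigen-gap and an induction over the d steps
give 1 - ⟨v̂_k, v_k⟩² ≤ C τ²t. The order of the error survives the induction because cross terms are
products of two small factors (`one_sub_inner_sq_le_of_deflate`, `exists_pmd_error_bound`).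

On the envelope side, the leading eigenvalues are simple, so the envelope is spanned by the v_j with
Σ_XY v_j ≠ 0 (`envelope_eq_span`). As v_jᵀ U v_j = ‖Σ_XY v_j‖², exactly u scores are positive and
Δ_U is the smallest of these. Once τ²t is small against Δ_U, the estimated scores put the right
components first, and the two projections are compared through traces
(`exists_frobNorm_error_bound`).

Probability enters only through t. Products of sub-Gaussian coordinates have an exponential moment,
so Bernstein's inequality and a union bound over the r² + pr entries allow t of order √(log r / n).
The rate condition makes τ²t small against both 1 and Δ_U. -/

noncomputable section

namespace SparseNIECE

/-! ### Successive deflation by approximate eigenvectors -/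

section Deflation

variable {E : Type*} [NormedAddCommGroup E] [InnerProductSpace ℝ E]

/-- The vector `(I - z₀z₀ᵀ) ⋯ (I - z_{k-1}z_{k-1}ᵀ) x`. -/
def deflate (z : ℕ → E) : ℕ → E → E
  | 0, x => x
  | k + 1, x => deflate z k (x - inner ℝ (z k) x • z k)

theorem norm_sq_sub_inner_smul_le {z : E} (hz : ‖z‖ ≤ 1) (x : E) :
    ‖x - inner ℝ z x • z‖ ^ 2 ≤ ‖x‖ ^ 2 - inner ℝ z x ^ 2 := by
  rw [norm_sub_sq_real, inner_smul_right, norm_smul, mul_pow, real_inner_comm z x,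
    Real.norm_eq_abs, sq_abs]
  have h : ‖z‖ ^ 2 ≤ 1 := pow_le_one₀ (norm_nonneg z) hz
  nlinarith [sq_nonneg (inner ℝ z x : ℝ), mul_le_mul_of_nonneg_left h (sq_nonneg (inner ℝ z x : ℝ))]

theorem norm_sub_inner_smul_le {z : E} (hz : ‖z‖ ≤ 1) (x : E) :
    ‖x - inner ℝ z x • z‖ ≤ ‖x‖ := by
  have h := norm_sq_sub_inner_smul_le hz x
  exact abs_le_of_sq_le_sq' (by nlinarith [sq_nonneg (inner ℝ z x : ℝ)]) (norm_nonneg x) |>.2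

theorem norm_deflate_le {z : ℕ → E} (k : ℕ) (hz : ∀ j < k, ‖z j‖ ≤ 1) (x : E) :
    ‖deflate z k x‖ ≤ ‖x‖ := by
  induction k generalizing x with
  | zero => exact le_rfl
  | succ k ih =>
    exact (ih (fun j hj => hz j (by omega)) _).trans
      (norm_sub_inner_smul_le (hz k (by omega)) x)

/-- A deflated vector differs from the original one by a combination of the `z j` whose
coefficients are controlled by the loss of norm and by the correlations with the `z j`. -/
theorem exists_deflate_eq_sub_sum {z : ℕ → E} (k : ℕ) (hz : ∀ j < k, ‖z j‖ ≤ 1) (x : E) :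
    ∃ a : ℕ → ℝ, deflate z k x = x - ∑ j ∈ Finset.range k, a j • z j ∧
      ∑ j ∈ Finset.range k, a j ^ 2 ≤ ‖x‖ ^ 2 - ‖deflate z k x‖ ^ 2 ∧
      ∀ β : ℝ, (∀ j < k, |inner ℝ (z j) x| ≤ β) → ∀ j < k, |a j| ≤ 2 ^ k * β := by
  induction k generalizing x with
  | zero => exact ⟨0, by simp [deflate]⟩
  | succ k ih =>
    obtain ⟨a, h1, h2, h3⟩ := ih (fun j hj => hz j (by omega)) (x - inner ℝ (z k) x • z k)
    have hne : ∀ j ∈ Finset.range k, Function.update a k (inner ℝ (z k) x) j = a j := by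
      intro j hj
      rw [Function.update_of_ne (Finset.mem_range.1 hj).ne]
    refine ⟨Function.update a k (inner ℝ (z k) x), ?_, ?_, ?_⟩
    · rw [deflate, h1, Finset.sum_range_succ, Function.update_self,
        Finset.sum_congr rfl fun j hj => congrArg (· • z j) (hne j hj)]
      abel
    · rw [deflate, Finset.sum_range_succ, Function.update_self,
        Finset.sum_congr rfl fun j hj => congrArg (· ^ 2) (hne j hj)]
      linarith [norm_sq_sub_inner_smul_le (hz k (by omega)) x]
    · intro β hβ j hj
      have hk := hβ k (by omega)
      have hβ0 : 0 ≤ β := (abs_nonneg _).trans hk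
      rcases Nat.lt_succ_iff_lt_or_eq.1 hj with hj | rfl
      · rw [Function.update_of_ne hj.ne]
        -- Removing the `z k` component changes each remaining correlation by at most `β`, so the
        -- bound doubles at every level; this is the source of `2 ^ k`.
        refine (h3 (2 * β) (fun i hi => ?_) j hj).trans_eq (by ring)
        rw [inner_sub_right, inner_smul_right]
        refine (abs_sub _ _).trans ?_
        have hzz : |inner ℝ (z i) (z k)| ≤ 1 :=
          (abs_real_inner_le_norm _ _).trans
            (mul_le_one₀ (hz i (by omega)) (norm_nonneg _) (hz k (by omega)))
        rw [abs_mul]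
        nlinarith [hβ i (by omega), abs_nonneg (inner ℝ (z k) x),
          mul_le_mul hk hzz (abs_nonneg _) hβ0]
      · rw [Function.update_self]
        nlinarith [one_le_pow₀ (n := j + 1) (one_le_two : (1 : ℝ) ≤ 2)]

/-- Bessel's inequality for two orthonormal vectors. -/
theorem inner_sq_add_inner_sq_le {v w x : E} (hv : ‖v‖ = 1) (hw : ‖w‖ = 1)
    (hvw : inner ℝ v w = 0) : inner ℝ x v ^ 2 + inner ℝ x w ^ 2 ≤ ‖x‖ ^ 2 := by
  have h := sq_nonneg ‖x - inner ℝ x v • v - inner ℝ x w • w‖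
  have hwv : inner ℝ w v = 0 := by rw [real_inner_comm, hvw]
  rw [← real_inner_self_eq_norm_sq] at h ⊢
  simp only [inner_sub_left, inner_sub_right, real_inner_smul_left, real_inner_smul_right,
    real_inner_self_eq_norm_sq v, real_inner_self_eq_norm_sq w, hv, hw, hvw, hwv,
    real_inner_comm x v, real_inner_comm x w] at h
  nlinarith [real_inner_comm x v, real_inner_comm x w]

/-- Since I - zzᵀ is symmetric it can be moved onto `v`, where it leaves a vector of squared norm at
most 1 - ⟨z, v⟩². -/
theorem abs_inner_sub_inner_smul_le {v z x : E} (hv : ‖v‖ = 1) (hz : ‖z‖ ≤ 1) (hx : ‖x‖ ≤ 1)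
    {β : ℝ} (hβ : 0 ≤ β) (h : 1 - inner ℝ z v ^ 2 ≤ β ^ 2) :
    |inner ℝ v (x - inner ℝ z x • z)| ≤ β := by
  have h1 : inner ℝ v (x - inner ℝ z x • z) = inner ℝ (v - inner ℝ z v • z) x := by
    rw [inner_sub_right, inner_sub_left, real_inner_smul_left, real_inner_smul_right,
      real_inner_comm z v]
    ring
  rw [h1]
  have h2 := norm_sq_sub_inner_smul_le hz v
  rw [hv] at h2
  have h3 : ‖v - inner ℝ z v • z‖ ≤ β :=
    abs_le_of_sq_le_sq' (by linarith) hβ |>.2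
  exact (abs_real_inner_le_norm _ _).trans (by nlinarith [norm_nonneg x])

/-- The deflated vectors are nearly orthogonal to the vectors which the `z j` approximate. -/
theorem abs_inner_deflate_le {z v : ℕ → E} {β : ℝ} (hβ : 0 ≤ β) (k : ℕ)
    (hz : ∀ j < k, ‖z j‖ ≤ 1) (hv : ∀ j < k, ‖v j‖ = 1)
    (hv0 : ∀ i < k, ∀ j < k, i ≠ j → inner ℝ (v i) (v j) = 0)
    (h : ∀ j < k, 1 - inner ℝ (z j) (v j) ^ 2 ≤ β ^ 2) {x : E} (hx : ‖x‖ ≤ 1) :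
    ∀ j < k, |inner ℝ (v j) (deflate z k x)| ≤ k * β := by
  induction k generalizing x with
  | zero => intro j hj; omega
  | succ k ih =>
    intro j hj
    have hx' := (norm_sub_inner_smul_le (hz k (by omega)) x).trans hx
    rcases Nat.lt_succ_iff_lt_or_eq.1 hj with hj | rfl
    · refine (ih (fun j hj => hz j (by omega)) (fun j hj => hv j (by omega))
        (fun i hi j hj => hv0 i (by omega) j (by omega)) (fun j hj => h j (by omega)) hx' j
        hj).trans ?_
      push_cast
      nlinarith
    · obtain ⟨a, h1, h2, -⟩ := exists_deflate_eq_sub_sum j (fun i hi => hz i (by omega))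
        (x - inner ℝ (z j) x • z j)
      rw [deflate, h1, inner_sub_right, inner_sum]
      refine (abs_sub _ _).trans ?_
      have h4 := abs_inner_sub_inner_smul_le (hv j (by omega)) (hz j (by omega)) hx hβ
        (h j (by omega))
      -- The later projections subtract multiples of the `z i`, `i < j`. Each is close to `v i`,
      -- which is orthogonal to `v j`, so Bessel leaves a correlation of at most `β`.
      have h5 : |∑ i ∈ Finset.range j, inner ℝ (v j) (a i • z i)| ≤ j * β := by
        refine (Finset.abs_sum_le_sum_abs _ _).trans ?_
        refine (Finset.sum_le_card_nsmul _ _ β fun i hi => ?_).trans_eq (by simp)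
        have hi' := Finset.mem_range.1 hi
        have hb := inner_sq_add_inner_sq_le (x := z i) (hv i (by omega)) (hv j (by omega))
          (hv0 i (by omega) j (by omega) hi'.ne)
        have hzi : ‖z i‖ ^ 2 ≤ 1 := pow_le_one₀ (norm_nonneg _) (hz i (by omega))
        have hb' : |inner ℝ (z i) (v j)| ≤ β :=
          abs_le_of_sq_le_sq (by linarith [h i (by omega)]) hβ
        have ha : |a i| ≤ 1 := by
          refine abs_le_of_sq_le_sq ?_ zero_le_one
          have := Finset.single_le_sum (f := fun i => a i ^ 2) (fun i _ => sq_nonneg (a i)) hi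
          have hx2 : ‖x - inner ℝ (z j) x • z j‖ ^ 2 ≤ 1 := pow_le_one₀ (norm_nonneg _) hx'
          nlinarith [sq_nonneg ‖deflate z j (x - inner ℝ (z j) x • z j)‖]
        rw [real_inner_smul_right, abs_mul, real_inner_comm]
        nlinarith [abs_nonneg (a i), abs_nonneg (inner ℝ (z i) (v j))]
      push_cast
      linarith

/-- One step of the deflation: if `z 0, …, z (k - 1)` approximate the eigenvectors
`v 0, …, v (k - 1)` up to an error `β ^ 2` and `z k` nearly maximizes the deflated form, then
`z k` approximates `v k`. -/
theorem one_sub_inner_sq_le_of_deflate {z v : ℕ → E} {q : E → ℝ} {l : ℕ → ℝ}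
    {L δ ε β : ℝ} (hL : 0 ≤ L) (hδ : 0 < δ) (hβ : 0 ≤ β) (k : ℕ)
    (hz : ∀ j < k + 1, ‖z j‖ ≤ 1) (hv : ∀ j < k + 1, ‖v j‖ = 1)
    (hv0 : ∀ i < k + 1, ∀ j < k + 1, i ≠ j → inner ℝ (v i) (v j) = 0)
    (hl : ∀ j < k + 1, 0 ≤ l j ∧ l j ≤ L) (hl' : 0 ≤ l (k + 1)) (hgap : δ ≤ l k - l (k + 1))
    (hlow : ∀ w, l k * inner ℝ (v k) w ^ 2 ≤ q w)
    (hup : ∀ w, q w ≤ ∑ j ∈ Finset.range k, l j * inner ℝ (v j) w ^ 2 +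
      l k * inner ℝ (v k) w ^ 2 + l (k + 1) * (‖w‖ ^ 2 - inner ℝ (v k) w ^ 2))
    (hopt : q (deflate z k (v k)) - ε ≤ q (deflate z k (z k)))
    (h : ∀ j < k, 1 - inner ℝ (z j) (v j) ^ 2 ≤ β ^ 2) :
    1 - inner ℝ (z k) (v k) ^ 2 ≤
      (1 + 2 * k) * ((k * (L * (k * β) ^ 2) + 2 * L * (k * (2 ^ k * β ^ 2)) + ε) / δ) +
        2 * k * β ^ 2 := by
  have hz' : ∀ j < k, ‖z j‖ ≤ 1 := fun j hj => hz j (by omega)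
  have hcorr : ∀ j < k, |inner ℝ (z j) (v k)| ≤ β := fun j hj => by
    have hb := inner_sq_add_inner_sq_le (x := z j) (hv j (by omega)) (hv k (by omega))
      (hv0 j (by omega) k (by omega) hj.ne)
    have hzj : ‖z j‖ ^ 2 ≤ 1 := pow_le_one₀ (norm_nonneg _) (hz' j hj)
    exact abs_le_of_sq_le_sq (by linarith [h j hj]) hβ
  set γ := (k * (L * (k * β) ^ 2) + 2 * L * (k * (2 ^ k * β ^ 2)) + ε) / δ with hγ
  set w := deflate z k (z k) with hw
  set b := inner ℝ (v k) w with hb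
  have hwn : ‖w‖ ^ 2 ≤ 1 :=
    pow_le_one₀ (norm_nonneg _) ((norm_deflate_le k hz' _).trans (hz k (by omega)))
  have hbw : b ^ 2 ≤ ‖w‖ ^ 2 := by
    rw [sq_le_sq, abs_norm]
    simpa [hv k (by omega)] using abs_real_inner_le_norm (v k) w
  -- the deflated form at `v k`
  have hlower : l k - 2 * L * (k * (2 ^ k * β ^ 2)) ≤ q (deflate z k (v k)) := by
    obtain ⟨a, h1, -, h3⟩ := exists_deflate_eq_sub_sum k hz' (v k)
    have h3 := h3 β hcorr
    refine le_trans ?_ (hlow _)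
    rw [h1, inner_sub_right, inner_sum, real_inner_self_eq_norm_sq, hv k (by omega)]
    -- The loss `s` is quadratic in `β`: the coefficients are O(β) and so are the correlations of
    -- the `z i` with `v k`. The bound follows from (1 - s)² ≥ 1 - 2s.
    set s := ∑ i ∈ Finset.range k, inner ℝ (v k) (a i • z i)
    have hs : |s| ≤ k * (2 ^ k * β ^ 2) := by
      refine (Finset.abs_sum_le_sum_abs _ _).trans ?_
      refine (Finset.sum_le_card_nsmul _ _ (2 ^ k * β ^ 2) fun i hi => ?_).trans_eq (by simp)
      have hi' := Finset.mem_range.1 hi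
      rw [real_inner_smul_right, abs_mul, real_inner_comm]
      calc |a i| * |inner ℝ (z i) (v k)| ≤ (2 ^ k * β) * β :=
            mul_le_mul (h3 i hi') (hcorr i hi') (abs_nonneg _) (by positivity)
        _ = _ := by ring
    have hs' := (abs_le.1 hs).2
    obtain ⟨hl0, hlL⟩ := hl k (by omega)
    have hy : 0 ≤ (k : ℝ) * (2 ^ k * β ^ 2) := by positivity
    nlinarith [mul_le_mul_of_nonneg_left hs' hl0, mul_le_mul_of_nonneg_right hlL hy,
      mul_nonneg hl0 (sq_nonneg s)]
  have hupper : q w ≤ k * (L * (k * β) ^ 2) + l k * b ^ 2 + l (k + 1) * (1 - b ^ 2) := by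
    refine (hup w).trans ?_
    have h1 : ∑ j ∈ Finset.range k, l j * inner ℝ (v j) w ^ 2 ≤ k * (L * (k * β) ^ 2) := by
      refine (Finset.sum_le_card_nsmul _ _ (L * (k * β) ^ 2) fun i hi => ?_).trans_eq (by simp)
      have hi' := Finset.mem_range.1 hi
      have h2 := abs_inner_deflate_le hβ k hz' (fun j hj => hv j (by omega))
        (fun i hi j hj => hv0 i (by omega) j (by omega)) h (hz k (by omega)) i hi'
      have h4 : inner ℝ (v i) w ^ 2 ≤ (k * β) ^ 2 :=
        sq_le_sq' (abs_le.1 h2).1 (abs_le.1 h2).2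
      exact mul_le_mul (hl i (by omega)).2 h4 (sq_nonneg _) hL
    have h2 : l (k + 1) * (‖w‖ ^ 2 - b ^ 2) ≤ l (k + 1) * (1 - b ^ 2) :=
      mul_le_mul_of_nonneg_left (by linarith) hl'
    linarith
  -- Near-optimality squeezes `l k - …` below `l k * b ^ 2 + l (k + 1) * (1 - b ^ 2) + …`; the gap
  -- turns this into a bound on `1 - b ^ 2`.
  have hb1 : 1 - b ^ 2 ≤ γ := by
    rw [hγ, le_div_iff₀ hδ]
    nlinarith [mul_le_mul_of_nonneg_right hgap (by linarith : (0 : ℝ) ≤ 1 - b ^ 2)]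
  -- back from the deflated vector to `z k`
  obtain ⟨a, h1, h2, -⟩ := exists_deflate_eq_sub_sum k hz' (z k)
  rw [← hw] at h1 h2
  have hzk : ‖z k‖ ^ 2 ≤ 1 := pow_le_one₀ (norm_nonneg _) (hz k (by omega))
  have hc : inner ℝ (z k) (v k) = b + ∑ i ∈ Finset.range k, a i * inner ℝ (z i) (v k) := by
    have : z k = w + ∑ j ∈ Finset.range k, a j • z j := by rw [h1]; abel
    conv_lhs => rw [this]
    rw [inner_add_left, sum_inner, hb, real_inner_comm]
    simp [real_inner_smul_left]
  set s := ∑ i ∈ Finset.range k, a i * inner ℝ (z i) (v k)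
  -- The squared coefficients sum to at most ‖z k‖² - ‖w‖² ≤ 1 - b² ≤ γ, and 2xy ≤ x² + y² is
  -- applied termwise.
  have hs : 2 * |s| ≤ k * (γ + β ^ 2) := by
    have : |s| ≤ k * ((γ + β ^ 2) / 2) := by
      refine (Finset.abs_sum_le_sum_abs _ _).trans ?_
      refine (Finset.sum_le_card_nsmul _ _ ((γ + β ^ 2) / 2) fun i hi => ?_).trans_eq (by simp)
      have ha := Finset.single_le_sum (f := fun i => a i ^ 2) (fun i _ => sq_nonneg (a i)) hi
      have hi' := Finset.mem_range.1 hi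
      have ha' : |a i| ^ 2 ≤ γ := by rw [sq_abs]; linarith
      have hβ' : |inner ℝ (z i) (v k)| ^ 2 ≤ β ^ 2 :=
        pow_le_pow_left₀ (abs_nonneg _) (hcorr i hi') 2
      rw [abs_mul]
      nlinarith [sq_nonneg (|a i| - |inner ℝ (z i) (v k)|)]
    linarith
  have hbabs : |b| ≤ 1 := abs_le_of_sq_le_sq (by linarith) zero_le_one
  rw [hc]
  have hbs : |b * s| ≤ |s| := by
    rw [abs_mul]; exact mul_le_of_le_one_left (abs_nonneg _) hbabs
  have hk0 : (0 : ℝ) ≤ k := Nat.cast_nonneg k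
  have hγ0 : 0 ≤ γ := le_trans (by linarith) hb1
  nlinarith [neg_abs_le (b * s), sq_nonneg s, mul_nonneg hk0 hγ0, mul_nonneg hk0 (sq_nonneg β)]

end Deflation

/-- Near-maximizers of the successively deflated form approximate the leading eigenvectors, with
an error that is linear in the inaccuracy `ε` of the maximization. -/
theorem exists_one_sub_inner_sq_le_mul {L δ : ℝ} (hL : 0 ≤ L) (hδ : 0 < δ) (d : ℕ) :
    ∃ C : ℝ, 0 ≤ C ∧ ∀ (r : ℕ) (z v : ℕ → Vec r) (q : Vec r → ℝ) (l : ℕ → ℝ) (ε : ℝ), 0 ≤ ε →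
      (∀ j < d, ‖z j‖ ≤ 1) → (∀ j < d, ‖v j‖ = 1) →
      (∀ i < d, ∀ j < d, i ≠ j → inner ℝ (v i) (v j) = 0) →
      (∀ j, 0 ≤ l j ∧ l j ≤ L) → (∀ k < d, δ ≤ l k - l (k + 1)) →
      (∀ k < d, ∀ w, l k * inner ℝ (v k) w ^ 2 ≤ q w) →
      (∀ k < d, ∀ w, q w ≤ ∑ j ∈ Finset.range k, l j * inner ℝ (v j) w ^ 2 +
        l k * inner ℝ (v k) w ^ 2 + l (k + 1) * (‖w‖ ^ 2 - inner ℝ (v k) w ^ 2)) →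
      (∀ k < d, q (deflate z k (v k)) - ε ≤ q (deflate z k (z k))) →
      ∀ k < d, 1 - inner ℝ (z k) (v k) ^ 2 ≤ C * ε := by
  induction d with
  | zero => exact ⟨0, le_rfl, fun _ _ _ _ _ _ _ _ _ _ _ _ _ _ _ k hk => by omega⟩
  | succ d ih =>
    obtain ⟨C, hC, ih⟩ := ih
    set C' : ℝ := (1 + 2 * d) * ((d * (L * d ^ 2 * C) + 2 * L * (d * (2 ^ d * C)) + 1) / δ) +
        2 * d * C with hC'
    refine ⟨max C C', le_max_of_le_left hC, ?_⟩
    intro r z v q l ε hε hz hv hv0 hl hgap hlow hup hopt k hk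
    have h := ih r z v q l ε hε (fun j hj => hz j (by omega)) (fun j hj => hv j (by omega))
      (fun i hi j hj => hv0 i (by omega) j (by omega)) hl (fun j hj => hgap j (by omega))
      (fun j hj => hlow j (by omega)) (fun j hj => hup j (by omega))
      (fun j hj => hopt j (by omega))
    rcases Nat.lt_succ_iff_lt_or_eq.1 hk with hk' | rfl
    · exact (h k hk').trans (mul_le_mul_of_nonneg_right (le_max_left _ _) hε)
    · refine le_trans ?_ (mul_le_mul_of_nonneg_right (le_max_right _ _) hε)
      -- With β² = Cε every term of the one-step bound is a multiple of `ε`; collecting the factors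
      -- gives `C'`.
      have hsq : √(C * ε) ^ 2 = C * ε := Real.sq_sqrt (mul_nonneg hC hε)
      have := one_sub_inner_sq_le_of_deflate (q := q) (l := l) hL hδ (Real.sqrt_nonneg (C * ε)) k
        hz hv hv0 (fun j _ => hl j) (hl (k + 1)).1 (hgap k hk) (hlow k hk) (hup k hk)
        (hopt k hk) (by simpa only [hsq] using h)
      refine this.trans_eq ?_
      rw [mul_pow, hsq, hC']
      ring

/-! ### Matrices as linear maps -/

theorem toEuclideanLin_mul_apply {k l m : ℕ} (A : Matrix (Fin k) (Fin l) ℝ)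
    (B : Matrix (Fin l) (Fin m) ℝ) (w : Vec m) :
    toEuclideanLin (A * B) w = toEuclideanLin A (toEuclideanLin B w) := by
  simp [Matrix.toLpLin_apply]

theorem inner_toEuclideanLin {k l : ℕ} (A : Matrix (Fin k) (Fin l) ℝ) (a : Vec k) (w : Vec l) :
    inner ℝ a (toEuclideanLin A w) = inner ℝ (toEuclideanLin Aᵀ a) w := by
  simp only [EuclideanSpace.inner_eq_star_dotProduct, Matrix.toLpLin_apply, star_trivial]
  rw [dotProduct_comm, dotProduct_mulVec, dotProduct_comm, mulVec_transpose]

theorem bilin_eq_inner {n k : ℕ} (A : Matrix (Fin n) (Fin k) ℝ) (a : Vec n) (w : Vec k) :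
    bilin A a w = inner ℝ a (toEuclideanLin A w) := by
  simp [bilin, EuclideanSpace.inner_eq_star_dotProduct, Matrix.toLpLin_apply, dotProduct_comm]

theorem quadForm_eq_inner {k : ℕ} (A : Matrix (Fin k) (Fin k) ℝ) (w : Vec k) :
    quadForm A w = inner ℝ w (toEuclideanLin A w) := bilin_eq_inner A w w

theorem quadForm_transpose_mul_self {k l : ℕ} (A : Matrix (Fin k) (Fin l) ℝ) (w : Vec l) :
    quadForm (Aᵀ * A) w = ‖toEuclideanLin A w‖ ^ 2 := by
  rw [quadForm_eq_inner, toEuclideanLin_mul_apply, inner_toEuclideanLin, transpose_transpose,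
    real_inner_self_eq_norm_sq]

theorem l1Norm_nonneg {k : ℕ} (w : Vec k) : 0 ≤ l1Norm w :=
  Finset.sum_nonneg fun _ _ => abs_nonneg _

theorem l1Norm_sub_smul_le {k : ℕ} (v w : Vec k) (c : ℝ) :
    l1Norm (v - c • w) ≤ l1Norm v + |c| * l1Norm w := by
  rw [l1Norm, l1Norm, l1Norm, Finset.mul_sum, ← Finset.sum_add_distrib]
  refine Finset.sum_le_sum fun i _ => ?_
  simpa [abs_mul] using abs_sub (v i) (c * w i)

/-- Each step subtracts some `z j` with a coefficient of modulus at most 1. Deflation thus preserves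
sparsity up to a constant factor. -/
theorem l1Norm_deflate_le {r : ℕ} {z : ℕ → Vec r} {τ : ℝ} (k : ℕ) (hz : ∀ j < k, ‖z j‖ ≤ 1)
    (hz1 : ∀ j < k, l1Norm (z j) ≤ τ) {x : Vec r} (hx : ‖x‖ ≤ 1) :
    l1Norm (deflate z k x) ≤ l1Norm x + k * τ := by
  induction k generalizing x with
  | zero => simp [deflate]
  | succ k ih =>
    have h1 := ih (fun j hj => hz j (by omega)) (fun j hj => hz1 j (by omega))
      ((norm_sub_inner_smul_le (hz k (by omega)) x).trans hx)
    have h2 := l1Norm_sub_smul_le x (z k) (inner ℝ (z k) x)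
    have h3 : |inner ℝ (z k) x| ≤ 1 :=
      (abs_real_inner_le_norm _ _).trans (mul_le_one₀ (hz k (by omega)) (norm_nonneg _) hx)
    have h4 := mul_le_mul h3 (hz1 k (by omega)) (l1Norm_nonneg _) zero_le_one
    rw [deflate]
    push_cast
    linarith

theorem abs_dotProduct_mulVec_le {k l : ℕ} {A : Matrix (Fin k) (Fin l) ℝ} {t : ℝ}
    (hA : ∀ i j, |A i j| ≤ t) (w : Vec l) (i : Fin k) :
    |(A *ᵥ w.ofLp) i| ≤ t * l1Norm w := by
  rw [mulVec, dotProduct, l1Norm, Finset.mul_sum]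
  refine (Finset.abs_sum_le_sum_abs _ _).trans (Finset.sum_le_sum fun j _ => ?_)
  rw [abs_mul]
  exact mul_le_mul_of_nonneg_right (hA i j) (abs_nonneg _)

/-- Hölder's inequality, used twice. This replaces an operator norm bound, which would involve the
growing dimension. -/
theorem abs_quadForm_le {k : ℕ} {A : Matrix (Fin k) (Fin k) ℝ} {t : ℝ}
    (hA : ∀ i j, |A i j| ≤ t) (w : Vec k) : |quadForm A w| ≤ t * l1Norm w ^ 2 := by
  rw [quadForm, dotProduct]
  refine (Finset.abs_sum_le_sum_abs _ _).trans ?_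
  have : t * l1Norm w ^ 2 = ∑ i, |w i| * (t * l1Norm w) := by
    rw [← Finset.sum_mul, ← l1Norm]; ring
  rw [this]
  refine Finset.sum_le_sum fun i _ => ?_
  rw [abs_mul]
  exact mul_le_mul_of_nonneg_left (abs_dotProduct_mulVec_le hA w i) (abs_nonneg _)

/-- Used with `k` the fixed number of predictors, so the factor `√k` is harmless. -/
theorem norm_toEuclideanLin_le_of_entries {k l : ℕ} {A : Matrix (Fin k) (Fin l) ℝ} {t : ℝ}
    (hA : ∀ i, ∀ j, |A i j| ≤ t) (w : Vec l) :
    ‖toEuclideanLin A w‖ ≤ √k * |t| * l1Norm w := by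
  rw [EuclideanSpace.norm_eq]
  refine Real.sqrt_le_iff.2 ⟨by have := l1Norm_nonneg w; positivity, ?_⟩
  refine (Finset.sum_le_card_nsmul _ _ ((t * l1Norm w) ^ 2) fun i _ => ?_).trans_eq ?_
  · rw [Real.norm_eq_abs]
    exact pow_le_pow_left₀ (abs_nonneg _) (abs_dotProduct_mulVec_le hA w i) 2
  · rw [mul_pow, mul_pow, mul_pow, Real.sq_sqrt (Nat.cast_nonneg k), sq_abs]
    simp [mul_assoc]

/-! ### The spectral decomposition -/

section Spectral

variable {r d : ℕ} {M : Matrix (Fin r) (Fin r) ℝ}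

theorem exists_orthonormalBasis_eigval (hM : M.IsHermitian) :
    ∃ e : OrthonormalBasis (Fin r) ℝ (Vec r),
      ∀ i, toEuclideanLin M (e i) = eigval M i • e i := by
  -- `eigenvalues` lists the sorted `eigenvalues₀` through a chosen bijection of the index type;
  -- undoing it restores the decreasing order.
  let σ : Fin r ≃ Fin r :=
    (Fintype.equivOfCardEq (Fintype.card_fin _)).symm.trans (finCongr (Fintype.card_fin r))
  refine ⟨hM.eigenvectorBasis.reindex σ, fun i => ?_⟩
  rw [OrthonormalBasis.reindex_apply, Matrix.toLpLin_apply, hM.mulVec_eigenvectorBasis]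
  have : hM.eigenvalues (σ.symm i) = eigval M i := by
    rw [eigval, dif_pos ⟨hM, i.2⟩, Matrix.IsHermitian.eigenvalues]
    congr 1
    simp [σ, Fin.ext_iff]
  rw [this, WithLp.toLp_smul]

theorem eigval_of_le (M : Matrix (Fin r) (Fin r) ℝ) {j : ℕ} (hj : r ≤ j) : eigval M j = 0 := by
  rw [eigval, dif_neg (by omega)]

theorem quadForm_of_eigenvector {w : Vec r} {c : ℝ} (h : toEuclideanLin M w = c • w)
    (hw : ‖w‖ = 1) : quadForm M w = c := by
  rw [quadForm_eq_inner, h, real_inner_smul_right, real_inner_self_eq_norm_sq, hw]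
  ring

theorem eigval_nonneg (hM : M.IsHermitian) (h0 : ∀ w, 0 ≤ quadForm M w) (j : ℕ) :
    0 ≤ eigval M j := by
  rcases lt_or_ge j r with hj | hj
  · obtain ⟨e, he⟩ := exists_orthonormalBasis_eigval hM
    rw [← quadForm_of_eigenvector (he ⟨j, hj⟩) (e.norm_eq_one _)]
    exact h0 _
  · exact (eigval_of_le M hj).ge

theorem eigval_le (hM : M.IsHermitian) {L : ℝ} (hL : 0 ≤ L)
    (h : ∀ w, quadForm M w ≤ L * ‖w‖ ^ 2) (j : ℕ) : eigval M j ≤ L := by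
  rcases lt_or_ge j r with hj | hj
  · obtain ⟨e, he⟩ := exists_orthonormalBasis_eigval hM
    have := h (e ⟨j, hj⟩)
    rwa [quadForm_of_eigenvector (he ⟨j, hj⟩) (e.norm_eq_one _), e.norm_eq_one, one_pow,
      mul_one] at this
  · exact (eigval_of_le M hj).trans_le hL

theorem eigval_antitone (hM : M.IsHermitian) (h0 : ∀ w, 0 ≤ quadForm M w) :
    Antitone (eigval M) := by
  intro i j hij
  rcases lt_or_ge j r with hj | hj
  · rw [eigval, eigval, dif_pos ⟨hM, hj⟩, dif_pos ⟨hM, by omega⟩]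
    exact hM.eigenvalues₀_antitone (by simpa [Fin.le_def] using hij)
  · rw [eigval_of_le M hj]
    exact eigval_nonneg hM h0 i

theorem quadForm_eq_sum_eigval {e : OrthonormalBasis (Fin r) ℝ (Vec r)}
    (he : ∀ i, toEuclideanLin M (e i) = eigval M i • e i) (hM : M.IsHermitian) (w : Vec r) :
    quadForm M w = ∑ i : Fin r, eigval M i * inner ℝ (e i) w ^ 2 := by
  rw [quadForm_eq_inner, ← e.sum_inner_mul_inner]
  refine Finset.sum_congr rfl fun i _ => ?_
  have hMt : Mᵀ = M := by simpa using hM.eq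
  rw [inner_toEuclideanLin, hMt, he, real_inner_smul_left, real_inner_comm]
  ring

theorem le_eigval_sub_of_le_eigenGap {δ : ℝ} (hgap : δ ≤ eigenGap M d) {j : ℕ} (hj : j < d) :
    δ ≤ eigval M j - eigval M (j + 1) :=
  hgap.trans (ciInf_le (Set.finite_range _).bddBelow (⟨j, hj⟩ : Fin d))

theorem IsLeadingEigenvectors.le {v : Fin d → Vec r} (hv : IsLeadingEigenvectors M v) :
    d ≤ r := by
  simpa using hv.orthonormal.linearIndependent.fintype_card_le_finrank

theorem IsLeadingEigenvectors.toEuclideanLin_eq {v : Fin d → Vec r}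
    (hv : IsLeadingEigenvectors M v) (j : Fin d) :
    toEuclideanLin M (v j) = eigval M j • v j := by
  rw [Matrix.toLpLin_apply, hv.eigen j]; rfl

theorem eigval_ne_of_eigenGap (hM : M.IsHermitian) (h0 : ∀ w, 0 ≤ quadForm M w) {δ : ℝ}
    (hδ : 0 < δ) (hgap : δ ≤ eigenGap M d) {i j : ℕ} (hj : j < d) (hij : i ≠ j) :
    eigval M i ≠ eigval M j := by
  rcases lt_or_gt_of_ne hij with h | h
  · have h1 := le_eigval_sub_of_le_eigenGap hgap (h.trans hj)
    have h2 := eigval_antitone hM h0 (Nat.succ_le_of_lt h)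
    simp only [Nat.succ_eq_add_one] at h2
    intro h3; linarith
  · have h1 := le_eigval_sub_of_le_eigenGap hgap hj
    have h2 := eigval_antitone hM h0 (Nat.succ_le_of_lt h)
    simp only [Nat.succ_eq_add_one] at h2
    intro h3; linarith

/-- The eigenspaces of the `d` leading eigenvalues are one-dimensional. -/
theorem eq_inner_smul_of_eigenGap (hM : M.IsHermitian) (h0 : ∀ w, 0 ≤ quadForm M w) {δ : ℝ}
    (hδ : 0 < δ) (hgap : δ ≤ eigenGap M d) {e : OrthonormalBasis (Fin r) ℝ (Vec r)}
    (he : ∀ i, toEuclideanLin M (e i) = eigval M i • e i) {j : Fin r} (hj : (j : ℕ) < d)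
    {w : Vec r} (hw : toEuclideanLin M w = eigval M j • w) : w = inner ℝ (e j) w • e j := by
  have h : ∀ i, i ≠ j → inner ℝ (e i) w = 0 := by
    intro i hij
    have hMt : Mᵀ = M := by simpa using hM.eq
    have h1 := inner_toEuclideanLin M (e i) w
    rw [hMt, he, hw, real_inner_smul_left, real_inner_smul_right] at h1
    have h2 := eigval_ne_of_eigenGap hM h0 hδ hgap hj (fun h => hij (Fin.ext h) : (i : ℕ) ≠ j)
    by_contra hne
    exact h2 (mul_right_cancel₀ hne h1).symm
  conv_lhs => rw [← e.sum_repr' w]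
  exact Finset.sum_eq_single j (fun i _ hij => by rw [h i hij, zero_smul]) (by simp)

/-- Simplicity forces `v j` to be plus or minus the basis vector, and squares do not see the sign.
-/
theorem inner_sq_eq_of_isLeadingEigenvectors (hM : M.IsHermitian)
    (h0 : ∀ w, 0 ≤ quadForm M w) {δ : ℝ} (hδ : 0 < δ) (hgap : δ ≤ eigenGap M d)
    {e : OrthonormalBasis (Fin r) ℝ (Vec r)}
    (he : ∀ i, toEuclideanLin M (e i) = eigval M i • e i) {v : Fin d → Vec r}
    (hv : IsLeadingEigenvectors M v) (j : Fin d) (w : Vec r) :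
    inner ℝ (e (j.castLE hv.le)) w ^ 2 = inner ℝ (v j) w ^ 2 := by
  have h := eq_inner_smul_of_eigenGap hM h0 hδ hgap he (j := j.castLE hv.le) j.2
    (hv.toEuclideanLin_eq j)
  set c := inner ℝ (e (j.castLE hv.le)) (v j)
  have hc : c ^ 2 = 1 := by
    have h1 := hv.orthonormal.1 j
    rw [h, norm_smul, e.norm_eq_one, mul_one, Real.norm_eq_abs] at h1
    rw [← sq_abs, h1, one_pow]
  rw [h, real_inner_smul_left, mul_pow, hc, one_mul]

/-- A vector with a one-dimensional eigenspace: every eigenvector is a multiple of it. -/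
theorem IsLeadingEigenvectors.exists_eq_smul (hM : M.IsHermitian)
    (h0 : ∀ w, 0 ≤ quadForm M w) {δ : ℝ} (hδ : 0 < δ) (hgap : δ ≤ eigenGap M d)
    {v : Fin d → Vec r} (hv : IsLeadingEigenvectors M v) (j : Fin d) {w : Vec r}
    (hw : toEuclideanLin M w = eigval M j • w) : ∃ c : ℝ, w = c • v j := by
  obtain ⟨e, he⟩ := exists_orthonormalBasis_eigval hM
  have h1 := eq_inner_smul_of_eigenGap hM h0 hδ hgap he (j := j.castLE hv.le) j.2
    (hv.toEuclideanLin_eq j)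
  have h2 := eq_inner_smul_of_eigenGap hM h0 hδ hgap he (j := j.castLE hv.le) j.2 hw
  set c := inner ℝ (e (j.castLE hv.le)) (v j)
  have hc : c ≠ 0 := by
    intro hc
    have h3 := hv.orthonormal.1 j
    rw [h1, hc, zero_smul, norm_zero] at h3
    exact zero_ne_one h3
  refine ⟨inner ℝ (e (j.castLE hv.le)) w / c, ?_⟩
  rw [h1, smul_smul, div_mul_cancel₀ _ hc]
  exact h2

/-- A finite sequence of vectors, extended by zero. -/
def extendZero {E : Type*} [Zero E] (v : Fin d → E) (j : ℕ) : E :=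
  if h : j < d then v ⟨j, h⟩ else 0

theorem extendZero_apply {E : Type*} [Zero E] (v : Fin d → E) {j : ℕ} (h : j < d) :
    extendZero v j = v ⟨j, h⟩ := dif_pos h

/-- The `c i` are the squared coordinates in an eigenbasis of the whole space; the first `d` of them
can be read off the given eigenvectors. -/
theorem exists_coordinates (hM : M.IsHermitian) (h0 : ∀ w, 0 ≤ quadForm M w) {δ : ℝ}
    (hδ : 0 < δ) (hgap : δ ≤ eigenGap M d) {v : Fin d → Vec r}
    (hv : IsLeadingEigenvectors M v) (w : Vec r) :
    ∃ c : ℕ → ℝ, (∀ i, 0 ≤ c i) ∧ (∀ j < d, c j = inner ℝ (extendZero v j) w ^ 2) ∧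
      ∑ i ∈ Finset.range r, c i = ‖w‖ ^ 2 ∧
      ∑ i ∈ Finset.range r, eigval M i * c i = quadForm M w := by
  obtain ⟨e, he⟩ := exists_orthonormalBasis_eigval hM
  set c : ℕ → ℝ := fun i => if h : i < r then inner ℝ (e ⟨i, h⟩) w ^ 2 else 0 with hc
  have hc' : ∀ i : Fin r, c i = inner ℝ (e i) w ^ 2 := fun i => by simp [hc]
  refine ⟨c, fun i => ?_, fun j hj => ?_, ?_, ?_⟩
  · simp only [hc]
    split_ifs
    · exact sq_nonneg _
    · exact le_rfl
  · rw [extendZero_apply v hj,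
      ← inner_sq_eq_of_isLeadingEigenvectors hM h0 hδ hgap he hv ⟨j, hj⟩ w]
    exact hc' ((⟨j, hj⟩ : Fin d).castLE hv.le)
  · rw [← e.sum_sq_norm_inner_right w, ← Fin.sum_univ_eq_sum_range]
    simp [hc']
  · rw [quadForm_eq_sum_eigval he hM, ← Fin.sum_univ_eq_sum_range (fun i => eigval M i * c i)]
    simp [hc']

theorem eigval_mul_inner_sq_le_quadForm (hM : M.IsHermitian) (h0 : ∀ w, 0 ≤ quadForm M w)
    {δ : ℝ} (hδ : 0 < δ) (hgap : δ ≤ eigenGap M d) {v : Fin d → Vec r}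
    (hv : IsLeadingEigenvectors M v) {k : ℕ} (hk : k < d) (w : Vec r) :
    eigval M k * inner ℝ (extendZero v k) w ^ 2 ≤ quadForm M w := by
  obtain ⟨c, hc0, hcv, -, hq⟩ := exists_coordinates hM h0 hδ hgap hv w
  rw [← hq, ← hcv k hk]
  exact Finset.single_le_sum (f := fun i => eigval M i * c i)
    (fun i _ => mul_nonneg (eigval_nonneg hM h0 i) (hc0 i))
    (Finset.mem_range.2 (hk.trans_le hv.le))

/-- All eigenvalues after the `k`-th are replaced by `eigval M (k + 1)`. Their weights sum to at
most ‖w‖² - ⟨v k, w⟩², since the weights before `k` are nonnegative. -/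
theorem quadForm_le_sum_eigval (hM : M.IsHermitian) (h0 : ∀ w, 0 ≤ quadForm M w)
    {δ : ℝ} (hδ : 0 < δ) (hgap : δ ≤ eigenGap M d) {v : Fin d → Vec r}
    (hv : IsLeadingEigenvectors M v) {k : ℕ} (hk : k < d) (w : Vec r) :
    quadForm M w ≤ ∑ j ∈ Finset.range k, eigval M j * inner ℝ (extendZero v j) w ^ 2 +
      eigval M k * inner ℝ (extendZero v k) w ^ 2 +
      eigval M (k + 1) * (‖w‖ ^ 2 - inner ℝ (extendZero v k) w ^ 2) := by
  obtain ⟨c, hc0, hcv, hn, hq⟩ := exists_coordinates hM h0 hδ hgap hv w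
  have hkr : k + 1 ≤ r := hk.trans_le hv.le
  rw [← hq, ← hn, ← hcv k hk, ← Finset.sum_range_add_sum_Ico _ hkr,
    ← Finset.sum_range_add_sum_Ico c hkr, Finset.sum_range_succ, Finset.sum_range_succ,
    Finset.sum_congr rfl fun j hj => by
      rw [hcv j ((Finset.mem_range.1 hj).trans hk)]]
  have h1 : ∑ i ∈ Finset.Ico (k + 1) r, eigval M i * c i ≤
      eigval M (k + 1) * ∑ i ∈ Finset.Ico (k + 1) r, c i := by
    rw [Finset.mul_sum]
    exact Finset.sum_le_sum fun i hi => mul_le_mul_of_nonneg_right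
      (eigval_antitone hM h0 (Finset.mem_Ico.1 hi).1) (hc0 i)
  have h2 : 0 ≤ eigval M (k + 1) * ∑ i ∈ Finset.range k, c i :=
    mul_nonneg (eigval_nonneg hM h0 _) (Finset.sum_nonneg fun i _ => hc0 i)
  linarith

end Spectral

/-! ### The penalized matrix decomposition -/

section PMD

variable {n r d : ℕ} {τ : ℝ}

/-- The left factor of a maximizing pair is the normalized image of the right factor. -/
theorem eq_bilin_smul_of_isMax {A : Matrix (Fin n) (Fin r) ℝ} {a : Vec n} {z : Vec r}
    (hf : PMDFeasible τ a z) (hmax : ∀ b w, PMDFeasible τ b w → bilin A b w ≤ bilin A a z) :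
    toEuclideanLin A z = bilin A a z • a ∧
      ∀ w, l1Norm w ≤ τ → ‖w‖ ≤ 1 → ‖toEuclideanLin A w‖ ≤ ‖toEuclideanLin A z‖ := by
  have key : ∀ w, l1Norm w ≤ τ → ‖w‖ ≤ 1 → ‖toEuclideanLin A w‖ ≤ bilin A a z := by
    intro w hw1 hw
    -- The best left factor for `w` is its normalized image. If the image vanishes this vector is
    -- zero, which is still feasible.
    have h := hmax (‖toEuclideanLin A w‖⁻¹ • toEuclideanLin A w) w
      ⟨hw1, pow_le_one₀ (norm_nonneg _) hw, ?_⟩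
    · rw [bilin_eq_inner, real_inner_smul_left, real_inner_self_eq_norm_sq, sq] at h
      refine le_trans (le_of_eq ?_) h
      rcases eq_or_ne ‖toEuclideanLin A w‖ 0 with h0 | h0
      · rw [h0]; simp
      · rw [inv_mul_cancel_left₀ h0]
    · refine pow_le_one₀ (norm_nonneg _) ?_
      rw [norm_smul, norm_inv, norm_norm]
      exact inv_mul_le_one
  have hz : ‖z‖ ≤ 1 := abs_le_one_iff_mul_self_le_one.2 (by nlinarith [hf.2.1]) |> le_of_abs_le
  have ha : ‖a‖ ≤ 1 := abs_le_one_iff_mul_self_le_one.2 (by nlinarith [hf.2.2]) |> le_of_abs_le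
  have hg := key z hf.1 hz
  have hle : bilin A a z ≤ ‖toEuclideanLin A z‖ := by
    rw [bilin_eq_inner]
    exact (real_inner_le_norm _ _).trans (mul_le_of_le_one_left (norm_nonneg _) ha)
  have heq := le_antisymm hle hg
  refine ⟨?_, fun w hw1 hw => heq ▸ key w hw1 hw⟩
  -- Equality case of Cauchy–Schwarz: with s = `bilin A a z`, ‖Az - s a‖² = s² - 2s² + s²‖a‖² ≤ 0.
  rw [← sub_eq_zero, ← norm_eq_zero, ← sq_eq_zero_iff]
  refine le_antisymm ?_ (sq_nonneg _)
  rw [norm_sub_sq_real, real_inner_smul_right, real_inner_comm, ← bilin_eq_inner, norm_smul,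
    ← heq, Real.norm_eq_abs, mul_pow, sq_abs]
  nlinarith [mul_le_mul_of_nonneg_left hf.2.2 (sq_nonneg (bilin A a z))]

/-- The right factors of the penalized matrix decomposition successively maximize the norm
`‖A (I - z₀z₀ᵀ) ⋯ (I - z_{k-1}z_{k-1}ᵀ) w‖` under the constraints. -/
theorem IsPMD.deflate_max {A : Matrix (Fin n) (Fin r) ℝ} {z : Fin d → Vec r}
    (h : IsPMD A τ z) :
    (∀ j, l1Norm (z j) ≤ τ ∧ ‖z j‖ ≤ 1) ∧
    ∀ k : Fin d, ∀ w, l1Norm w ≤ τ → ‖w‖ ≤ 1 →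
      ‖toEuclideanLin A (deflate (extendZero z) k w)‖ ≤
        ‖toEuclideanLin A (deflate (extendZero z) k (z k))‖ := by
  obtain ⟨D, a, hD0, hD⟩ := h
  have hdef : ∀ k, k ≤ d → ∀ w,
      toEuclideanLin (D k) w = toEuclideanLin A (deflate (extendZero z) k w) := by
    intro k
    induction k with
    | zero => intro _ w; rw [hD0, deflate]
    | succ k ih =>
      intro hk w
      obtain ⟨hf, hmax, hrec⟩ := hD ⟨k, hk⟩
      rw [deflate, ← ih (by omega), extendZero_apply z (by omega : k < d)]
      simp only at hrec
      rw [hrec, map_sub, map_smul, map_sub, map_smul]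
      simp only at hf hmax
      -- Since σ̂û is the image of `z k` under the current matrix, subtracting σ̂ û ẑᵀ amounts to
      -- composing on the right with I - ẑẑᵀ.
      rw [(eq_bilin_smul_of_isMax hf hmax).1]
      simp only [LinearMap.sub_apply, LinearMap.smul_apply]
      congr 1
      ext i
      simp [Matrix.toLpLin_apply, vecMulVec_mulVec, EuclideanSpace.inner_eq_star_dotProduct,
        dotProduct_comm]
      ring
  refine ⟨fun j => ⟨(hD j).1.1, ?_⟩, fun k w hw1 hw => ?_⟩
  · exact abs_le_one_iff_mul_self_le_one.2 (by nlinarith [(hD j).1.2.1]) |> le_of_abs_le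
  · rw [← hdef k k.2.le, ← hdef k k.2.le]
    exact (eq_bilin_smul_of_isMax (hD k).1 (hD k).2.1).2 w hw1 hw

theorem norm_sq_toEuclideanLin_dataMatrix (y : Fin n → Vec r) (w : Vec r) :
    ‖toEuclideanLin ((√(n : ℝ))⁻¹ • dataMatrix y) w‖ ^ 2 = quadForm (sampleCov y y) w := by
  rw [← quadForm_transpose_mul_self, sampleCov, transpose_smul, Matrix.smul_mul,
    Matrix.mul_smul, smul_smul,
    ← mul_inv, Real.mul_self_sqrt (Nat.cast_nonneg n)]

/-- The right factors of the penalized matrix decomposition of the data matrix approximate the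
leading eigenvectors of the population covariance matrix `M`. -/
theorem exists_pmd_error_bound {L δ : ℝ} (hL : 0 ≤ L) (hδ : 0 < δ) (d : ℕ) :
    ∃ C : ℝ, 0 ≤ C ∧ ∀ (n r : ℕ) (y : Fin n → Vec r) (M : Matrix (Fin r) (Fin r) ℝ)
      (v z : Fin d → Vec r) (τ t : ℝ), 0 ≤ t → M.IsHermitian → (∀ w, 0 ≤ quadForm M w) →
      (∀ w, quadForm M w ≤ L * ‖w‖ ^ 2) → IsLeadingEigenvectors M v → δ ≤ eigenGap M d →
      (∀ j, l1Norm (v j) ≤ τ) → (∀ i j, |(sampleCov y y - M) i j| ≤ t) →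
      IsPMD ((√(n : ℝ))⁻¹ • dataMatrix y) τ z →
      ∀ j, 1 - inner ℝ (z j) (v j) ^ 2 ≤ C * (τ ^ 2 * t) := by
  obtain ⟨C, hC, h⟩ := exists_one_sub_inner_sq_le_mul hL hδ d
  refine ⟨C * (2 * (1 + d) ^ 2), by positivity, ?_⟩
  intro n r y M v z τ t ht hM h0 hML hv hgap hτ hS hz j
  obtain ⟨hz1, hmax⟩ := hz.deflate_max
  have hτ0 : 0 ≤ τ := (l1Norm_nonneg _).trans (hτ j)
  set ε := t * ((1 + d) * τ) ^ 2 with hε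
  have hε0 : 0 ≤ ε := by positivity
  have hzn : ∀ i < d, ‖extendZero z i‖ ≤ 1 := fun i hi => by
    rw [extendZero_apply z hi]; exact (hz1 _).2
  have herr : ∀ k < d, ∀ w, l1Norm w ≤ τ → ‖w‖ ≤ 1 →
      |quadForm (sampleCov y y) (deflate (extendZero z) k w) -
        quadForm M (deflate (extendZero z) k w)| ≤ ε := by
    intro k hk w hw1 hw
    have h1 := abs_quadForm_le hS (deflate (extendZero z) k w)
    have h2 : l1Norm (deflate (extendZero z) k w) ≤ (1 + d) * τ := by
      refine (l1Norm_deflate_le k (fun i hi => hzn i (hi.trans hk)) (τ := τ)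
        (fun i hi => ?_) hw).trans ?_
      · rw [extendZero_apply z (hi.trans hk)]; exact (hz1 _).1
      · have : (k : ℝ) ≤ d := by exact_mod_cast hk.le
        nlinarith
    have h3 : ∀ x, quadForm (sampleCov y y - M) x =
        quadForm (sampleCov y y) x - quadForm M x := fun x => by
      simp [quadForm, sub_mulVec, dotProduct_sub]
    rw [h3] at h1
    refine h1.trans (mul_le_mul_of_nonneg_left ?_ ht)
    exact pow_le_pow_left₀ (l1Norm_nonneg _) h2 2
  have hvn : ∀ i < d, ‖extendZero v i‖ = 1 := fun i hi => by
    rw [extendZero_apply v hi]; exact hv.orthonormal.1 _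
  -- The inaccuracy is `2 * ε` because passing between the sample and population forms costs `ε` at
  -- `v k` and `ε` at `z k`.
  have key := h r (extendZero z) (extendZero v) (quadForm M) (eigval M) (2 * ε) (by positivity)
    hzn hvn
    (fun i hi k hk hik => by
      rw [extendZero_apply v hi, extendZero_apply v hk]
      exact hv.orthonormal.2 (by simpa using hik))
    (fun i => ⟨eigval_nonneg hM h0 i, eigval_le hM hL hML i⟩)
    (fun k hk => le_eigval_sub_of_le_eigenGap hgap hk)
    (fun k hk w => eigval_mul_inner_sq_le_quadForm hM h0 hδ hgap hv hk w)
    (fun k hk w => quadForm_le_sum_eigval hM h0 hδ hgap hv hk w)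
    (fun k hk => ?_) j j.2
  · rw [extendZero_apply z j.2, extendZero_apply v j.2] at key
    refine key.trans_eq ?_
    rw [hε]; ring
  · rw [extendZero_apply z hk, extendZero_apply v hk]
    have h1 := (abs_le.1 (herr k hk _ (hτ ⟨k, hk⟩) (hv.orthonormal.1 _).le)).1
    have h2 := (abs_le.1 (herr k hk _ (hz1 ⟨k, hk⟩).1 (hz1 ⟨k, hk⟩).2)).2
    have h3 := pow_le_pow_left₀ (norm_nonneg _)
      (hmax ⟨k, hk⟩ (v ⟨k, hk⟩) (hτ _) (hv.orthonormal.1 _).le) 2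
    rw [norm_sq_toEuclideanLin_dataMatrix, norm_sq_toEuclideanLin_dataMatrix] at h3
    simp only at h3
    linarith

end PMD

/-! ### Projections, reducing subspaces and envelopes -/

section Projection

variable {k l : ℕ}

theorem toEuclideanLin_projMatrix_apply (R : Submodule ℝ (Vec k)) (w : Vec k) :
    toEuclideanLin (projMatrix R) w = R.starProjection w := by
  rw [projMatrix, LinearEquiv.apply_symm_apply]
  rfl

theorem projMatrix_transpose (R : Submodule ℝ (Vec k)) : (projMatrix R)ᵀ = projMatrix R := by
  refine Matrix.toEuclideanLin.injective (LinearMap.ext fun w => ext_inner_right ℝ fun x => ?_)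
  rw [← inner_toEuclideanLin, toEuclideanLin_projMatrix_apply, toEuclideanLin_projMatrix_apply]
  exact (R.starProjection_isSymmetric w x).symm

theorem projMatrix_mul_self (R : Submodule ℝ (Vec k)) :
    projMatrix R * projMatrix R = projMatrix R := by
  refine Matrix.toEuclideanLin.injective (LinearMap.ext fun w => ?_)
  rw [toEuclideanLin_mul_apply, toEuclideanLin_projMatrix_apply, toEuclideanLin_projMatrix_apply]
  exact Submodule.starProjection_eq_self_iff.2 (Submodule.starProjection_apply_mem _ _)

theorem trace_projMatrix (R : Submodule ℝ (Vec k)) :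
    (projMatrix R).trace = Module.finrank ℝ R := by
  have h : LinearMap.IsProj R (toEuclideanLin (projMatrix R)) :=
    ⟨fun w => by
      rw [toEuclideanLin_projMatrix_apply]; exact Submodule.starProjection_apply_mem _ _,
    fun w hw => by
      rw [toEuclideanLin_projMatrix_apply]; exact Submodule.starProjection_eq_self_iff.2 hw⟩
  rw [← h.trace, Matrix.toEuclideanLin, Matrix.toLpLin_eq_toLin, Matrix.trace_toLin_eq]

theorem frobNorm_sq {k l : ℕ} (A : Matrix (Fin k) (Fin l) ℝ) :
    frobNorm A ^ 2 = (Aᵀ * A).trace := by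
  have h : 0 ≤ ∑ i, ∑ j, A i j ^ 2 := by positivity
  rw [frobNorm, Real.sq_sqrt h, Finset.sum_comm]
  simp [Matrix.trace, Matrix.mul_apply, sq]

theorem frobNorm_sub_projMatrix_sq (R S : Submodule ℝ (Vec k)) :
    frobNorm (projMatrix R - projMatrix S) ^ 2 =
      Module.finrank ℝ R + Module.finrank ℝ S - 2 * (projMatrix R * projMatrix S).trace := by
  rw [frobNorm_sq, transpose_sub, projMatrix_transpose, projMatrix_transpose, sub_mul, mul_sub,
    mul_sub, projMatrix_mul_self, projMatrix_mul_self, trace_sub, trace_sub, trace_sub,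
    trace_projMatrix, trace_projMatrix, trace_mul_comm (projMatrix S)]
  ring

theorem starProjection_span_orthonormal {ι : Type*} [Fintype ι] {b : ι → Vec k}
    (hb : Orthonormal ℝ b) (w : Vec k) :
    (Submodule.span ℝ (Set.range b)).starProjection w = ∑ i, inner ℝ (b i) w • b i := by
  refine Submodule.eq_starProjection_of_mem_orthogonal ?_ ?_
  · exact Submodule.sum_mem _ fun i _ => Submodule.smul_mem _ _ (Submodule.subset_span ⟨i, rfl⟩)
  · rw [Submodule.mem_orthogonal']
    intro x hx
    induction hx using Submodule.span_induction with
    | mem x hx =>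
      obtain ⟨i, rfl⟩ := hx
      rw [inner_sub_left, hb.inner_left_fintype, real_inner_comm]
      simp
    | zero => simp
    | add x y _ _ hx hy => rw [inner_add_right, hx, hy, add_zero]
    | smul c x _ hx => rw [real_inner_smul_right, hx, mul_zero]

theorem projMatrix_span_orthonormal {ι : Type*} [Fintype ι] {b : ι → Vec k}
    (hb : Orthonormal ℝ b) :
    projMatrix (Submodule.span ℝ (Set.range b)) =
      ∑ i, vecMulVec (b i).ofLp (b i).ofLp := by
  refine Matrix.toEuclideanLin.injective (LinearMap.ext fun w => ?_)
  rw [toEuclideanLin_projMatrix_apply, starProjection_span_orthonormal hb, map_sum,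
    LinearMap.sum_apply]
  refine Finset.sum_congr rfl fun i _ => ?_
  ext j
  simp [Matrix.toLpLin_apply, vecMulVec_mulVec, EuclideanSpace.inner_eq_star_dotProduct,
    dotProduct_comm]

/-- The distance between the projections onto the span of an orthonormal family and onto the
span of approximations in the unit ball. -/
theorem frobNorm_sub_projMatrix_span_sq_le {ι : Type*} [Fintype ι] {b z : ι → Vec k}
    (hb : Orthonormal ℝ b) (hz : ∀ i, ‖z i‖ ≤ 1) {γ : ℝ}
    (h : ∀ i, 1 - inner ℝ (z i) (b i) ^ 2 ≤ γ) :
    frobNorm (projMatrix (Submodule.span ℝ (Set.range z)) -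
      projMatrix (Submodule.span ℝ (Set.range b))) ^ 2 ≤ 2 * (Fintype.card ι * γ) := by
  set R := Submodule.span ℝ (Set.range z)
  -- The approximations need not be independent; an upper bound on the rank suffices.
  have h1 : (Module.finrank ℝ R : ℝ) ≤ Fintype.card ι := by
    exact_mod_cast finrank_range_le_card z
  have h2 : Module.finrank ℝ (Submodule.span ℝ (Set.range b)) = Fintype.card ι :=
    finrank_span_eq_card hb.linearIndependent
  have h3 : (Fintype.card ι : ℝ) * (1 - γ) ≤
      (projMatrix R * projMatrix (Submodule.span ℝ (Set.range b))).trace := by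
    rw [projMatrix_span_orthonormal hb, Finset.mul_sum, trace_sum, ← nsmul_eq_mul]
    refine Finset.card_nsmul_le_sum _ _ _ fun i _ => ?_
    rw [mul_vecMulVec, trace_vecMulVec]
    have h4 : (projMatrix R *ᵥ (b i).ofLp) ⬝ᵥ (b i).ofLp =
        inner ℝ (b i) (R.starProjection (b i)) := by
      rw [← toEuclideanLin_projMatrix_apply, EuclideanSpace.inner_eq_star_dotProduct]
      simp [Matrix.toLpLin_apply]
    have h5 : inner ℝ (b i) (R.starProjection (b i)) = ‖R.starProjection (b i)‖ ^ 2 := by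
      rw [← real_inner_self_eq_norm_sq]
      conv_lhs => rw [← Submodule.starProjection_eq_self_iff.2
        (Submodule.starProjection_apply_mem R (b i))]
      exact (R.starProjection_isSymmetric _ _).symm
    have h6 : inner ℝ (z i) (b i) = inner ℝ (z i) (R.starProjection (b i)) := by
      have := R.starProjection_isSymmetric (z i) (b i)
      simp only [ContinuousLinearMap.coe_coe] at this
      rw [← this, Submodule.starProjection_eq_self_iff.2
        (Submodule.subset_span (Set.mem_range_self i))]
    -- As `z i` lies in `R` and the unit ball, the projection of `b i` onto `R` is at least as long
    -- as the correlation. Squared and summed over `i`, this bounds the trace below.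
    have h7 : |inner ℝ (z i) (b i)| ≤ ‖R.starProjection (b i)‖ := by
      rw [h6]
      exact (abs_real_inner_le_norm _ _).trans (mul_le_of_le_one_left (norm_nonneg _) (hz i))
    have h8 := pow_le_pow_left₀ (abs_nonneg _) h7 2
    rw [sq_abs] at h8
    rw [h4, h5]
    linarith [h i]
  rw [frobNorm_sub_projMatrix_sq, h2]
  linarith

/-- Multiplying the decomposition of `M` by the projection P on either side leaves PMP, so MP = PM.
-/
theorem IsReducing.comm {M : Matrix (Fin k) (Fin k) ℝ} {R : Submodule ℝ (Vec k)}
    (h : IsReducing M R) (w : Vec k) :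
    toEuclideanLin M (R.starProjection w) = R.starProjection (toEuclideanLin M w) := by
  have hP := projMatrix_mul_self R
  set P := projMatrix R with hPdef
  have hPQ : P * (1 - P) = 0 := by rw [mul_sub, hP, mul_one, sub_self]
  have hQP : (1 - P) * P = 0 := by rw [sub_mul, hP, one_mul, sub_self]
  have h1 : M * P = P * M := by
    rw [IsReducing, ← hPdef] at h
    have h2 : M * P = P * M * P := by
      conv_lhs => rw [h]
      rw [add_mul, mul_assoc (P * M), hP, mul_assoc ((1 - P) * M), hQP, mul_zero, add_zero]
    have h3 : P * M = P * M * P := by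
      conv_lhs => rw [h]
      rw [mul_add, ← mul_assoc, ← mul_assoc, hP, ← mul_assoc, ← mul_assoc, hPQ, zero_mul,
        zero_mul, add_zero]
    rw [h2, ← h3]
  rw [← toEuclideanLin_projMatrix_apply, ← toEuclideanLin_projMatrix_apply,
    ← toEuclideanLin_mul_apply, ← toEuclideanLin_mul_apply, ← hPdef, h1]

/-- A symmetric map preserving `R` also preserves its orthogonal complement, hence commutes with the
projection. -/
theorem isReducing_of_invariant {M : Matrix (Fin k) (Fin k) ℝ} (hM : M.IsHermitian)
    {R : Submodule ℝ (Vec k)} (h : ∀ w ∈ R, toEuclideanLin M w ∈ R) : IsReducing M R := by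
  have hMt : Mᵀ = M := by simpa using hM.eq
  have h1 : M * projMatrix R = projMatrix R * M := by
    refine Matrix.toEuclideanLin.injective (LinearMap.ext fun w => ?_)
    rw [toEuclideanLin_mul_apply, toEuclideanLin_mul_apply, toEuclideanLin_projMatrix_apply,
      toEuclideanLin_projMatrix_apply]
    refine (Submodule.eq_starProjection_of_mem_orthogonal
      (h _ (Submodule.starProjection_apply_mem _ _)) ?_).symm
    rw [← map_sub, Submodule.mem_orthogonal]
    intro x hx
    rw [inner_toEuclideanLin, hMt]
    exact (Submodule.mem_orthogonal _ _).1 (Submodule.sub_starProjection_mem_orthogonal w) _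
      (h x hx)
  have hP := projMatrix_mul_self R
  have h2 : (1 - projMatrix R) * M = M * (1 - projMatrix R) := by
    rw [sub_mul, mul_sub, h1, one_mul, mul_one]
  have h3 : (1 - projMatrix R) * (1 - projMatrix R) = 1 - projMatrix R := by
    rw [sub_mul, one_mul, mul_sub, mul_one, hP, sub_self, sub_zero]
  rw [IsReducing, ← h1, mul_assoc, hP, h2, mul_assoc, h3, ← mul_add, add_sub_cancel, mul_one]

/-- ‖Bᵀw‖² = ⟨w, BBᵀw⟩, and BBᵀw lies in the column space. -/
theorem inner_eq_zero_of_colSpan {B : Matrix (Fin k) (Fin l) ℝ} {w : Vec k}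
    (hw : ∀ x ∈ colSpan B, inner ℝ w x = 0) : toEuclideanLin Bᵀ w = 0 := by
  rw [← inner_self_eq_zero (𝕜 := ℝ), ← inner_toEuclideanLin]
  exact hw _ ⟨_, rfl⟩

theorem colSpan_le_envelope (M : Matrix (Fin k) (Fin k) ℝ) (B : Matrix (Fin k) (Fin l) ℝ) :
    colSpan B ≤ envelope M B :=
  le_sInf fun _ hR => hR.2

/-- An envelope inside the span of leading eigenvectors with simple eigenvalues is spanned by
those eigenvectors that are not orthogonal to the column space. -/
theorem envelope_eq_span {d : ℕ} {M : Matrix (Fin k) (Fin k) ℝ} (hM : M.IsHermitian)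
    (h0 : ∀ w, 0 ≤ quadForm M w) {δ : ℝ} (hδ : 0 < δ) (hgap : δ ≤ eigenGap M d)
    {v : Fin d → Vec k} (hv : IsLeadingEigenvectors M v) {B : Matrix (Fin k) (Fin l) ℝ}
    (henv : envelope M B ≤ Submodule.span ℝ (Set.range v)) :
    envelope M B = Submodule.span ℝ (v '' {j | toEuclideanLin Bᵀ (v j) ≠ 0}) := by
  refine le_antisymm (sInf_le ⟨?_, ?_⟩) (le_sInf fun R hR => ?_)
  · refine isReducing_of_invariant hM fun w hw => ?_
    induction hw using Submodule.span_induction with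
    | mem x hx =>
      obtain ⟨j, hj, rfl⟩ := hx
      rw [hv.toEuclideanLin_eq]
      exact Submodule.smul_mem _ _ (Submodule.subset_span ⟨j, hj, rfl⟩)
    | zero => rw [map_zero]; exact Submodule.zero_mem _
    | add x y _ _ hx hy => rw [map_add]; exact Submodule.add_mem _ hx hy
    | smul c x _ hx => rw [map_smul]; exact Submodule.smul_mem _ _ hx
  · rintro x ⟨y, rfl⟩
    have hx := henv (colSpan_le_envelope M B ⟨y, rfl⟩)
    rw [← Submodule.starProjection_eq_self_iff.2 hx, starProjection_span_orthonormal hv.orthonormal]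
    refine Submodule.sum_mem _ fun j _ => ?_
    by_cases hj : toEuclideanLin Bᵀ (v j) = 0
    · rw [inner_toEuclideanLin, hj, inner_zero_left, zero_smul]
      exact Submodule.zero_mem _
    · exact Submodule.smul_mem _ _ (Submodule.subset_span ⟨j, hj, rfl⟩)
  · rw [Submodule.span_le]
    rintro _ ⟨j, hj, rfl⟩
    -- The projection onto a reducing `R` commutes with `M`, so it keeps `v j` in its
    -- one-dimensional eigenspace. If `c = 0`, `v j` is orthogonal to the column space, against the
    -- choice of `j`; otherwise `v j` lies in `R`.
    obtain ⟨c, hc⟩ := hv.exists_eq_smul hM h0 hδ hgap j (w := R.starProjection (v j)) (by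
      rw [hR.1.comm, hv.toEuclideanLin_eq, map_smul])
    rcases eq_or_ne c 0 with rfl | hc0
    · refine absurd (inner_eq_zero_of_colSpan fun x hx => ?_) hj
      have hvR : v j ∈ Rᗮ := by
        have := Submodule.sub_starProjection_mem_orthogonal (K := R) (v j)
        rwa [hc, zero_smul, sub_zero] at this
      exact (Submodule.mem_orthogonal' _ _).1 hvR x (hR.2 hx)
    · have : v j = c⁻¹ • R.starProjection (v j) := by rw [hc, inv_smul_smul₀ hc0]
      rw [this]
      exact R.smul_mem _ (Submodule.starProjection_apply_mem _ _)

end Projection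

/-! ### Selection by scores -/

/-- If the members of `J` have the largest scores, then sorting puts `J` first. -/
theorem perm_mem_iff_lt_card {d : ℕ} {φ : Fin d → ℝ} {π : Equiv.Perm (Fin d)}
    (hπ : Antitone fun j => φ (π j)) {J : Finset (Fin d)}
    (hJ : ∀ j ∈ J, ∀ i ∉ J, φ i < φ j) (i : Fin d) : π i ∈ J ↔ (i : ℕ) < J.card := by
  set T : Finset (Fin d) := J.map π.symm.toEmbedding with hT
  have hmem : ∀ i, i ∈ T ↔ π i ∈ J := fun i => by simp [hT]
  have hcard : T.card = J.card := by simp [hT]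
  have hlow : ∀ i j, i ≤ j → π j ∈ J → π i ∈ J := by
    intro i j hij hj
    by_contra hi
    exact absurd (hπ hij) (not_le.2 (hJ _ hj _ hi))
  rw [← hcard]
  constructor
  · intro hi
    -- The positions occupied by `J` form an initial segment, so its cardinality determines it.
    have : Finset.Iic i ⊆ T := fun j hj => (hmem j).2 (hlow j i (Finset.mem_Iic.1 hj) hi)
    have := Finset.card_le_card this
    rw [Fin.card_Iic] at this
    omega
  · intro hi
    by_contra hni
    have : T ⊆ Finset.Iio i := fun j hj => Finset.mem_Iio.2 (lt_of_not_ge fun hij =>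
      hni (hlow i j hij ((hmem j).1 hj)))
    have := Finset.card_le_card this
    rw [Fin.card_Iio] at this
    omega

/-- For nonnegative scores with exactly `u ≥ 1` positive ones, the gap after the `u`-th largest
score is the least positive score. -/
theorem sortedDesc_sub_pos_and_le {d : ℕ} {φ : Fin d → ℝ} (hφ : ∀ j, 0 ≤ φ j)
    {J : Finset (Fin d)} (hJ : ∀ j, j ∈ J ↔ 0 < φ j) (hu : 1 ≤ J.card) :
    0 < sortedDesc φ (J.card - 1) - sortedDesc φ J.card ∧
      ∀ j ∈ J, sortedDesc φ (J.card - 1) - sortedDesc φ J.card ≤ φ j := by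
  set π := Tuple.sort (fun i => -φ i) with hπ
  have hanti : Antitone fun j => φ (π j) := fun i j hij => by
    have := Tuple.monotone_sort (fun i => -φ i) hij
    simpa using this
  have hsel := perm_mem_iff_lt_card hanti (J := J) fun j hj i hi => by
    have h1 := (hJ j).1 hj
    have h2 := not_lt.1 (mt (hJ i).2 hi)
    linarith
  have hd : J.card ≤ d := by simpa using J.card_le_univ
  -- If `J` is everything this is the default value; otherwise the score lies outside `J` and
  -- vanishes.
  have h1 : sortedDesc φ J.card = 0 := by
    rw [sortedDesc]
    split_ifs with h
    · have : π ⟨J.card, h⟩ ∉ J := by rw [hsel]; simp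
      exact le_antisymm (not_lt.1 (mt (hJ _).2 this)) (hφ _)
    · rfl
  have hlt : J.card - 1 < d := by omega
  have h2 : sortedDesc φ (J.card - 1) = φ (π ⟨J.card - 1, hlt⟩) := dif_pos hlt
  rw [h1, sub_zero, h2]
  refine ⟨(hJ _).1 ((hsel _).2 (by simp only; omega)), fun j hj => ?_⟩
  have h3 : π (π.symm j) ∈ J := by simpa using hj
  rw [hsel] at h3
  have h4 : π.symm j ≤ ⟨J.card - 1, hlt⟩ := by rw [Fin.le_def]; simp only; omega
  simpa using hanti h4

/-! ### The estimation error when the sample covariances are close to the population ones -/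

theorem sampleCov_transpose {n k l : ℕ} (x : Fin n → Vec k) (y : Fin n → Vec l) :
    (sampleCov x y)ᵀ = sampleCov y x := by
  simp [sampleCov]

section Deterministic

variable {r d l u : ℕ} {M : Matrix (Fin r) (Fin r) ℝ} {δ : ℝ} {v : Fin d → Vec r}
  {B : Matrix (Fin r) (Fin l) ℝ}

theorem card_support_eq_finrank_envelope (hM : M.IsHermitian) (h0 : ∀ w, 0 ≤ quadForm M w)
    (hδ : 0 < δ) (hgap : δ ≤ eigenGap M d) (hv : IsLeadingEigenvectors M v)
    (henv : envelope M B ≤ Submodule.span ℝ (Set.range v)) {J : Finset (Fin d)}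
    (hJ : ∀ j, j ∈ J ↔ toEuclideanLin Bᵀ (v j) ≠ 0) :
    envelope M B = Submodule.span ℝ (Set.range fun j : J => v j) ∧
      J.card = Module.finrank ℝ (envelope M B) := by
  have h1 : v '' {j | toEuclideanLin Bᵀ (v j) ≠ 0} = Set.range fun j : J => v j := by
    ext x
    simp [← hJ]
  have h2 : envelope M B = Submodule.span ℝ (Set.range fun j : J => v j) := by
    rw [envelope_eq_span hM h0 hδ hgap hv henv, h1]
  have h3 : Orthonormal ℝ fun j : J => v j := hv.orthonormal.comp _ Subtype.val_injective
  refine ⟨h2, ?_⟩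
  rw [h2, finrank_span_eq_card h3.linearIndependent, Fintype.card_coe]

/-- The score gap is positive and bounds the scores of the envelope components from below. -/
theorem scoreGap_pos_and_le (hM : M.IsHermitian) (h0 : ∀ w, 0 ≤ quadForm M w)
    (hδ : 0 < δ) (hgap : δ ≤ eigenGap M d) (hv : IsLeadingEigenvectors M v)
    (henv : envelope M B ≤ Submodule.span ℝ (Set.range v))
    (hu : Module.finrank ℝ (envelope M B) = u) (hu1 : 1 ≤ u) :
    0 < scoreGap (B * Bᵀ) v u ∧
      ∀ j, toEuclideanLin Bᵀ (v j) ≠ 0 →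
        scoreGap (B * Bᵀ) v u ≤ ‖toEuclideanLin Bᵀ (v j)‖ ^ 2 := by
  classical
  set J : Finset (Fin d) := Finset.univ.filter fun j => toEuclideanLin Bᵀ (v j) ≠ 0 with hJdef
  have hJ : ∀ j, j ∈ J ↔ toEuclideanLin Bᵀ (v j) ≠ 0 := fun j => by simp [hJdef]
  have hq : ∀ j, quadForm (B * Bᵀ) (v j) = ‖toEuclideanLin Bᵀ (v j)‖ ^ 2 := fun j => by
    rw [← quadForm_transpose_mul_self, transpose_transpose]
  have hcard := (card_support_eq_finrank_envelope hM h0 hδ hgap hv henv hJ).2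
  rw [hu] at hcard
  have h := sortedDesc_sub_pos_and_le (φ := fun j => quadForm (B * Bᵀ) (v j)) (J := J)
    (fun j => by rw [hq]; exact sq_nonneg _) (fun j => by
      rw [hJ, hq, sq_pos_iff, norm_ne_zero_iff]) (by omega)
  rw [hcard] at h
  refine ⟨h.1, fun j hj => ?_⟩
  rw [← hq]
  exact h.2 j ((hJ j).2 hj)

end Deterministic

/-- The error of the estimator on the event that the entries of the sample covariance matrices
differ from those of the population by at most `t`. -/
theorem exists_frobNorm_error_bound {L δ : ℝ} (hL : 0 ≤ L) (hδ : 0 < δ) (p d : ℕ) :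
    ∃ C : ℝ, 0 ≤ C ∧ ∀ (n r u : ℕ) (x : Fin n → Vec p) (y : Fin n → Vec r)
      (M : Matrix (Fin r) (Fin r) ℝ) (B : Matrix (Fin r) (Fin p) ℝ)
      (v : Fin d → Vec r) (τ t : ℝ) (E : Submodule ℝ (Vec r)), 0 ≤ t → t ≤ 1 →
      M.IsHermitian → (∀ w, 0 ≤ quadForm M w) → (∀ w, quadForm M w ≤ L * ‖w‖ ^ 2) →
      (∀ w, ‖toEuclideanLin Bᵀ w‖ ≤ L * ‖w‖) →
      IsLeadingEigenvectors M v → δ ≤ eigenGap M d →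
      envelope M B ≤ Submodule.span ℝ (Set.range v) →
      Module.finrank ℝ (envelope M B) = u → 1 ≤ u →
      (∀ j, l1Norm (v j) ≤ τ) → (∀ i j, |(sampleCov y y - M) i j| ≤ t) →
      (∀ i j, |(sampleCov x y - Bᵀ) i j| ≤ t) →
      C * (τ ^ 2 * t) < 1 → C * (τ ^ 2 * t) < scoreGap (B * Bᵀ) v u →
      IsSparseNIECE x y d u τ E →
      frobNorm (projMatrix E - projMatrix (envelope M B)) ^ 2 ≤ C * (τ ^ 2 * t) := by
  obtain ⟨C, hC, hpmd⟩ := exists_pmd_error_bound hL hδ d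
  -- The summands serve three ends: the final projection bound, `C * ε ≤ 1 / 2` (which keeps the
  -- correlations above 1/2), and 64θ² < Δ.
  refine ⟨2 * d * C + 2 * C + 128 * (p + L ^ 2 * C), by positivity, ?_⟩
  intro n r u x y M B v τ t E ht ht1 hM h0 hML hBL hv hgap henv hu hu1 hτ hSM hSB hsmall hgapU hE
  obtain ⟨z, π, hz, hπ, rfl⟩ := hE
  have hclose := hpmd n r y M v z τ t ht hM h0 hML hv hgap hτ hSM hz
  have hz1 := hz.deflate_max.1
  classical
  set J : Finset (Fin d) := Finset.univ.filter fun j => toEuclideanLin Bᵀ (v j) ≠ 0 with hJdef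
  have hJ : ∀ j, j ∈ J ↔ toEuclideanLin Bᵀ (v j) ≠ 0 := fun j => by simp [hJdef]
  obtain ⟨hspan, hcard⟩ := card_support_eq_finrank_envelope hM h0 hδ hgap hv henv hJ
  rw [hu] at hcard
  obtain ⟨-, hΔ⟩ := scoreGap_pos_and_le hM h0 hδ hgap hv henv hu hu1
  set Δ := scoreGap (B * Bᵀ) v u
  set ε := τ ^ 2 * t with hε
  have hε0 : 0 ≤ ε := by positivity
  have hp0 : (0 : ℝ) ≤ p := Nat.cast_nonneg p
  have hLC : 0 ≤ L ^ 2 * C := by positivity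
  -- the perturbation of the square roots of the scores
  set θ := √p * t * τ + L * √(C * ε) with hθ
  -- Nonnegativity of `τ` is read off some ‖v j‖₁, so an index is needed.
  have hτ0 : ∀ _ : Fin d, 0 ≤ τ := fun j => (l1Norm_nonneg _).trans (hτ j)
  have hθ0 : ∀ _ : Fin d, 0 ≤ θ := fun j => by have := hτ0 j; positivity
  have hθsq : θ ^ 2 ≤ 2 * (p + L ^ 2 * C) * ε := by
    have h1 : (√p * t * τ) ^ 2 ≤ p * ε := by
      rw [mul_pow, mul_pow, Real.sq_sqrt hp0, hε]
      have : t ^ 2 ≤ t := by nlinarith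
      nlinarith [mul_le_mul_of_nonneg_left this (mul_nonneg hp0 (sq_nonneg τ))]
    have h2 : (L * √(C * ε)) ^ 2 = L ^ 2 * C * ε := by
      rw [mul_pow, Real.sq_sqrt (mul_nonneg hC hε0)]; ring
    rw [hθ]
    nlinarith [sq_nonneg (√p * t * τ - L * √(C * ε))]
  have hpert : ∀ j, ‖toEuclideanLin (sampleCov x y) (z j) -
      (inner ℝ (v j) (z j) : ℝ) • toEuclideanLin Bᵀ (v j)‖ ≤ θ := by
    intro j
    have h1 : toEuclideanLin (sampleCov x y) (z j) -
        (inner ℝ (v j) (z j) : ℝ) • toEuclideanLin Bᵀ (v j) =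
        toEuclideanLin (sampleCov x y - Bᵀ) (z j) +
          toEuclideanLin Bᵀ (z j - (inner ℝ (v j) (z j) : ℝ) • v j) := by
      rw [map_sub, map_sub, map_smul, LinearMap.sub_apply]; abel
    have h2 := norm_toEuclideanLin_le_of_entries hSB (z j)
    rw [abs_of_nonneg ht] at h2
    have h3 : √p * t * l1Norm (z j) ≤ √p * t * τ :=
      mul_le_mul_of_nonneg_left (hz1 j).1 (by positivity)
    have h4 : ‖z j - (inner ℝ (v j) (z j) : ℝ) • v j‖ ≤ √(C * ε) := by
      refine Real.le_sqrt_of_sq_le ?_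
      have h5 := norm_sq_sub_inner_smul_le (hv.orthonormal.1 j).le (z j)
      have h6 : ‖z j‖ ^ 2 ≤ 1 := pow_le_one₀ (norm_nonneg _) (hz1 j).2
      have h7 := hclose j
      rw [real_inner_comm] at h7
      linarith
    rw [h1]
    refine (norm_add_le _ _).trans ?_
    have h8 := (hBL (z j - (inner ℝ (v j) (z j) : ℝ) • v j)).trans
      (mul_le_mul_of_nonneg_left h4 hL)
    linarith
  have hq : ∀ j, quadForm (sampleU x y) (z j) = ‖toEuclideanLin (sampleCov x y) (z j)‖ ^ 2 := by
    intro j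
    rw [sampleU, ← sampleCov_transpose x y, quadForm_transpose_mul_self]
  have hsel := perm_mem_iff_lt_card (φ := fun j => quadForm (sampleU x y) (z j)) (π := π) hπ
      (J := J) fun j hj i hi => by
    have hi0 : toEuclideanLin Bᵀ (v i) = 0 := by
      by_contra h; exact hi ((hJ i).2 h)
    have h1 : ‖toEuclideanLin (sampleCov x y) (z i)‖ ≤ θ := by
      have := hpert i
      rwa [hi0, smul_zero, sub_zero] at this
    have h2 := hpert j
    rw [norm_sub_rev] at h2
    have h3 := norm_sub_norm_le ((inner ℝ (v j) (z j) : ℝ) • toEuclideanLin Bᵀ (v j))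
      (toEuclideanLin (sampleCov x y) (z j))
    rw [norm_smul, Real.norm_eq_abs] at h3
    have hcb : 1 / 2 ≤ |(inner ℝ (v j) (z j) : ℝ)| := by
      have h7 := hclose j
      rw [real_inner_comm, ← sq_abs] at h7
      have h8 : C * ε ≤ 1 / 2 := by
        have : 0 ≤ 2 * d * C * ε := by positivity
        have : 0 ≤ 128 * (p + L ^ 2 * C) * ε := by positivity
        linarith
      by_contra! h9
      nlinarith [abs_nonneg (inner ℝ (v j) (z j) : ℝ)]
    have h4 : 8 * θ < ‖toEuclideanLin Bᵀ (v j)‖ := by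
      refine lt_of_pow_lt_pow_left₀ 2 (norm_nonneg _) ?_
      refine lt_of_lt_of_le ?_ (hΔ j ((hJ j).1 hj))
      refine lt_of_le_of_lt ?_ hgapU
      have : 0 ≤ (2 * d * C + 2 * C) * ε := by positivity
      nlinarith
    have h5 : θ < ‖toEuclideanLin (sampleCov x y) (z j)‖ := by
      have := mul_le_mul_of_nonneg_right hcb (norm_nonneg (toEuclideanLin Bᵀ (v j)))
      have := hθ0 j
      linarith
    rw [hq, hq]
    exact pow_lt_pow_left₀ (lt_of_le_of_lt h1 h5) (norm_nonneg _) two_ne_zero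
  have himage : (fun j => z (π j)) '' {j : Fin d | (j : ℕ) < u} =
      Set.range fun j : J => z j := by
    ext w
    simp only [Set.mem_image, Set.mem_ofPred_eq, Set.mem_range, Subtype.exists, exists_prop]
    constructor
    · rintro ⟨j, hj, rfl⟩
      exact ⟨π j, (hsel j).2 (by omega), rfl⟩
    · rintro ⟨j, hj, rfl⟩
      refine ⟨π.symm j, ?_, by simp⟩
      rw [← hcard, ← hsel]
      simpa using hj
  rw [himage, hspan]
  have hfin := frobNorm_sub_projMatrix_span_sq_le (b := fun j : J => v j)
    (z := fun j : J => z j) (hv.orthonormal.comp _ Subtype.val_injective) (fun j => (hz1 j).2)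
    (fun j => hclose j)
  refine hfin.trans ?_
  have hJd : (Fintype.card J : ℝ) ≤ d := by
    rw [Fintype.card_coe]
    exact_mod_cast (by simpa using J.card_le_univ : J.card ≤ d)
  have h1 := mul_le_mul_of_nonneg_right hJd (mul_nonneg hC hε0)
  have h2 : 0 ≤ (2 * C + 128 * (p + L ^ 2 * C)) * ε := by positivity
  linarith

/-! ### Concentration of empirical means of products of sub-Gaussian variables -/

section Concentration

variable {Ω : Type*} [MeasurableSpace Ω] {μ : Measure Ω}

/-- The two-sided tail bound `P(|A| ≥ t) ≤ 2 exp(-t² / σ²)`. -/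
def HasTailBound (μ : Measure Ω) (A : Ω → ℝ) (σ : ℝ) : Prop :=
  ∀ t : ℝ, 0 ≤ t → μ.real {ω | t ≤ |A ω|} ≤ 2 * Real.exp (-(t ^ 2 / σ ^ 2))

/-- Layer cake formula: the expectation is 1 + ∫ P(A² ≥ 2σ²t) eᵗ dt ≤ 1 + ∫ 2e⁻²ᵗeᵗ dt = 3. -/
theorem HasTailBound.lintegral_exp_le [IsProbabilityMeasure μ] {A : Ω → ℝ} {σ : ℝ}
    (hσ : 0 < σ) (hA : AEMeasurable A μ) (h : HasTailBound μ A σ) :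
    ∫⁻ ω, ENNReal.ofReal (Real.exp (A ω ^ 2 / (2 * σ ^ 2))) ∂μ ≤ 3 := by
  have hlayer := lintegral_comp_eq_lintegral_meas_le_mul (f := fun ω => A ω ^ 2 / (2 * σ ^ 2))
    (g := Real.exp) μ (Eventually.of_forall fun ω => by positivity)
    ((hA.pow_const 2).div_const _) (fun t _ => Real.continuous_exp.intervalIntegrable _ _)
    (Eventually.of_forall fun t => (Real.exp_pos t).le)
  have hbound : ∫⁻ t in Set.Ioi (0 : ℝ), μ {ω | t ≤ A ω ^ 2 / (2 * σ ^ 2)} *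
      ENNReal.ofReal (Real.exp t) ≤ 2 := by
    calc ∫⁻ t in Set.Ioi (0 : ℝ), μ {ω | t ≤ A ω ^ 2 / (2 * σ ^ 2)} *
          ENNReal.ofReal (Real.exp t)
        ≤ ∫⁻ t in Set.Ioi (0 : ℝ), ENNReal.ofReal (2 * Real.exp (-t)) := by
          refine setLIntegral_mono' measurableSet_Ioi fun t ht => ?_
          have ht0 : (0 : ℝ) < t := ht
          have hset : {ω | t ≤ A ω ^ 2 / (2 * σ ^ 2)} = {ω | √(t * (2 * σ ^ 2)) ≤ |A ω|} := by
            ext ω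
            simp only [Set.mem_ofPred_eq]
            rw [le_div_iff₀ (by positivity), Real.sqrt_le_left (abs_nonneg _), sq_abs]
          have h1 := h (√(t * (2 * σ ^ 2))) (Real.sqrt_nonneg _)
          rw [← hset, Real.sq_sqrt (by positivity)] at h1
          have h2 : t * (2 * σ ^ 2) / σ ^ 2 = 2 * t := by field_simp
          rw [h2] at h1
          rw [← ofReal_measureReal, ← ENNReal.ofReal_mul measureReal_nonneg]
          refine ENNReal.ofReal_le_ofReal ?_
          calc μ.real {ω | t ≤ A ω ^ 2 / (2 * σ ^ 2)} * Real.exp t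
              ≤ 2 * Real.exp (-(2 * t)) * Real.exp t :=
                mul_le_mul_of_nonneg_right h1 (Real.exp_pos t).le
            _ = 2 * Real.exp (-t) := by rw [mul_assoc, ← Real.exp_add]; ring_nf
      _ = 2 := by
          rw [← ofReal_integral_eq_lintegral_ofReal ((integrableOn_exp_neg_Ioi 0).const_mul 2)
            (Eventually.of_forall fun t => by positivity), integral_const_mul,
            integral_exp_neg_Ioi_zero]
          simp
  rw [← hlayer] at hbound
  calc ∫⁻ ω, ENNReal.ofReal (Real.exp (A ω ^ 2 / (2 * σ ^ 2))) ∂μ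
      = ∫⁻ ω, (ENNReal.ofReal (∫ t in (0 : ℝ)..A ω ^ 2 / (2 * σ ^ 2), Real.exp t) + 1) ∂μ := by
        refine lintegral_congr fun ω => ?_
        rw [integral_exp, Real.exp_zero, ← ENNReal.ofReal_one,
          ← ENNReal.ofReal_add _ zero_le_one, sub_add_cancel]
        rw [sub_nonneg]
        exact Real.one_le_exp (by positivity)
    _ ≤ 2 + 1 := by
        rw [lintegral_add_right _ measurable_const]
        simpa using add_le_add_left hbound 1
    _ = 3 := by norm_num

/-- The product of two sub-Gaussian variables has an exponential moment. -/
theorem HasTailBound.integral_exp_mul_le [IsProbabilityMeasure μ] {A B : Ω → ℝ} {σ : ℝ}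
    (hσ : 0 < σ) (hA : AEMeasurable A μ) (hB : AEMeasurable B μ) (hA' : HasTailBound μ A σ)
    (hB' : HasTailBound μ B σ) :
    Integrable (fun ω => Real.exp ((2 * σ ^ 2)⁻¹ * |A ω * B ω|)) μ ∧
      ∫ ω, Real.exp ((2 * σ ^ 2)⁻¹ * |A ω * B ω|) ∂μ ≤ 3 := by
  have key : ∀ C : Ω → ℝ, AEMeasurable C μ → HasTailBound μ C σ →
      Integrable (fun ω => Real.exp (C ω ^ 2 / (2 * σ ^ 2))) μ ∧
        ∫ ω, Real.exp (C ω ^ 2 / (2 * σ ^ 2)) ∂μ ≤ 3 := by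
    intro C hC hC'
    have h1 := hC'.lintegral_exp_le hσ hC
    have hm : AEStronglyMeasurable (fun ω => Real.exp (C ω ^ 2 / (2 * σ ^ 2))) μ :=
      (Real.measurable_exp.comp_aemeasurable
        ((hC.pow_const 2).div_const _)).aestronglyMeasurable
    have hpos : 0 ≤ᵐ[μ] fun ω => Real.exp (C ω ^ 2 / (2 * σ ^ 2)) :=
      Eventually.of_forall fun ω => (Real.exp_pos _).le
    refine ⟨⟨hm, ?_⟩, ?_⟩
    · rw [hasFiniteIntegral_iff_ofReal hpos]
      exact h1.trans_lt (by norm_num)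
    · rw [integral_eq_lintegral_of_nonneg_ae hpos hm]
      exact ENNReal.toReal_le_of_le_ofReal (by norm_num) (by simpa using h1)
  obtain ⟨hAi, hA3⟩ := key A hA hA'
  obtain ⟨hBi, hB3⟩ := key B hB hB'
  -- The arithmetic-geometric mean inequality, in the exponent and then for the exponentials;
  -- independence of `A` and `B` plays no role.
  have hle : ∀ ω, Real.exp ((2 * σ ^ 2)⁻¹ * |A ω * B ω|) ≤
      (Real.exp (A ω ^ 2 / (2 * σ ^ 2)) + Real.exp (B ω ^ 2 / (2 * σ ^ 2))) / 2 := by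
    intro ω
    have h1 : (2 * σ ^ 2)⁻¹ * |A ω * B ω| ≤
        A ω ^ 2 / (2 * σ ^ 2) / 2 + B ω ^ 2 / (2 * σ ^ 2) / 2 := by
      have : |A ω * B ω| ≤ (A ω ^ 2 + B ω ^ 2) / 2 := by
        rw [abs_mul]
        nlinarith [sq_nonneg (|A ω| - |B ω|), sq_abs (A ω), sq_abs (B ω)]
      calc _ ≤ (2 * σ ^ 2)⁻¹ * ((A ω ^ 2 + B ω ^ 2) / 2) :=
            mul_le_mul_of_nonneg_left this (by positivity)
        _ = _ := by ring
    refine (Real.exp_le_exp.2 h1).trans ?_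
    rw [Real.exp_add]
    have h2 : ∀ x : ℝ, Real.exp x = Real.exp (x / 2) ^ 2 := fun x => by
      rw [← Real.exp_nat_mul]; congr 1; push_cast; ring
    rw [h2 (A ω ^ 2 / (2 * σ ^ 2)), h2 (B ω ^ 2 / (2 * σ ^ 2))]
    nlinarith [sq_nonneg (Real.exp (A ω ^ 2 / (2 * σ ^ 2) / 2) -
      Real.exp (B ω ^ 2 / (2 * σ ^ 2) / 2))]
  have hint : Integrable (fun ω =>
      (Real.exp (A ω ^ 2 / (2 * σ ^ 2)) + Real.exp (B ω ^ 2 / (2 * σ ^ 2))) / 2) μ :=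
    (hAi.add hBi).div_const 2
  have hm : AEStronglyMeasurable (fun ω => Real.exp ((2 * σ ^ 2)⁻¹ * |A ω * B ω|)) μ :=
    (Real.measurable_exp.comp_aemeasurable
      ((continuous_abs.measurable.comp_aemeasurable (hA.mul hB)).const_mul _)).aestronglyMeasurable
  have hi : Integrable (fun ω => Real.exp ((2 * σ ^ 2)⁻¹ * |A ω * B ω|)) μ := by
    refine hint.mono' hm (Eventually.of_forall fun ω => ?_)
    rw [Real.norm_eq_abs, Real.abs_exp]
    exact hle ω
  refine ⟨hi, (integral_mono hi hint hle).trans ?_⟩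
  rw [integral_div, integral_add hAi hBi]
  linarith

/-- Both signs follow from eˣ(1 - x) ≤ 1: it gives eˣ - 1 ≤ x eˣ for x ≥ 0, and eˣ ≤ 1/(1 - x) ≤ 1 +
x + x² for x ≤ 0. -/
theorem exp_le_one_add_add_sq_mul (x : ℝ) : Real.exp x ≤ 1 + x + x ^ 2 * Real.exp |x| := by
  have h1 := Real.add_one_le_exp (-x)
  have h2 : Real.exp x * Real.exp (-x) = 1 := by rw [← Real.exp_add]; simp
  have h3 : Real.exp x * (1 - x) ≤ 1 := by nlinarith [Real.exp_pos x]
  have h4 := Real.add_one_le_exp x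
  rcases le_total 0 x with hx | hx
  · rw [abs_of_nonneg hx]
    nlinarith
  · have h5 : 1 ≤ Real.exp |x| := Real.one_le_exp (abs_nonneg x)
    nlinarith [sq_nonneg x, mul_le_mul_of_nonneg_left h5 (sq_nonneg x)]

theorem sq_le_mul_exp {κ : ℝ} (hκ : 0 < κ) (w : ℝ) :
    w ^ 2 ≤ 8 / κ ^ 2 * Real.exp (κ / 2 * |w|) := by
  have h := Real.quadratic_le_exp_of_nonneg (x := κ / 2 * |w|) (by positivity)
  rw [div_mul_eq_mul_div, le_div_iff₀ (by positivity)]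
  have : (κ / 2 * |w|) ^ 2 = κ ^ 2 / 4 * w ^ 2 := by rw [mul_pow, sq_abs]; ring
  nlinarith [mul_nonneg (half_pos hκ).le (abs_nonneg w)]

/-! ### Bernstein's inequality from an exponential moment. -/

section ExpMoment

variable {W : Ω → ℝ} {κ : ℝ}

theorem integrable_of_integrable_exp_abs (hκ : 0 < κ) (hW : AEMeasurable W μ)
    (hi : Integrable (fun ω => Real.exp (κ * |W ω|)) μ) : Integrable W μ := by
  refine (hi.const_mul κ⁻¹).mono' hW.aestronglyMeasurable (Eventually.of_forall fun ω => ?_)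
  rw [Real.norm_eq_abs, ← div_eq_inv_mul, le_div_iff₀ hκ]
  linarith [Real.add_one_le_exp (κ * |W ω|)]

theorem abs_integral_le_of_integral_exp_abs_le (hκ : 0 < κ)
    (hi : Integrable (fun ω => Real.exp (κ * |W ω|)) μ)
    (h3 : ∫ ω, Real.exp (κ * |W ω|) ∂μ ≤ 3) : |∫ ω, W ω ∂μ| ≤ 3 / κ := by
  have h := norm_integral_le_of_norm_le (f := W) (hi.const_mul κ⁻¹)
    (Eventually.of_forall fun ω => by
      rw [Real.norm_eq_abs, ← div_eq_inv_mul, le_div_iff₀ hκ]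
      linarith [Real.add_one_le_exp (κ * |W ω|)])
  rw [integral_const_mul, Real.norm_eq_abs] at h
  refine h.trans ?_
  rw [div_eq_inv_mul]
  exact mul_le_mul_of_nonneg_left h3 (by positivity)

theorem integrable_exp_mul_of_abs_le (hW : AEMeasurable W μ)
    (hi : Integrable (fun ω => Real.exp (κ * |W ω|)) μ) {s : ℝ} (hs : |s| ≤ κ) :
    Integrable (fun ω => Real.exp (s * W ω)) μ := by
  refine hi.mono' (Real.measurable_exp.comp_aemeasurable
    (hW.const_mul s)).aestronglyMeasurable (Eventually.of_forall fun ω => ?_)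
  rw [Real.norm_eq_abs, Real.abs_exp, Real.exp_le_exp]
  refine (le_abs_self _).trans ?_
  rw [abs_mul]
  exact mul_le_mul_of_nonneg_right hs (abs_nonneg _)

variable [IsProbabilityMeasure μ]

/-- Second-order expansion of the exponential. Half of the exponent κ absorbs W², the other half
absorbs e^{|sW|}; the constant is 24 = 8 · 3. -/
theorem mgf_le_exp_of_integral_exp_abs_le (hκ : 0 < κ) (hW : AEMeasurable W μ)
    (hi : Integrable (fun ω => Real.exp (κ * |W ω|)) μ)
    (h3 : ∫ ω, Real.exp (κ * |W ω|) ∂μ ≤ 3) {s : ℝ} (hs : |s| ≤ κ / 2) :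
    mgf W μ s ≤ Real.exp (s * ∫ ω, W ω ∂μ + 24 / κ ^ 2 * s ^ 2) := by
  have hWi := integrable_of_integrable_exp_abs hκ hW hi
  have hle : ∀ ω, Real.exp (s * W ω) ≤
      1 + s * W ω + 8 / κ ^ 2 * s ^ 2 * Real.exp (κ * |W ω|) := by
    intro ω
    refine (exp_le_one_add_add_sq_mul _).trans (add_le_add_right ?_ _)
    have h1 : Real.exp |s * W ω| ≤ Real.exp (κ / 2 * |W ω|) := by
      rw [Real.exp_le_exp, abs_mul]
      exact mul_le_mul_of_nonneg_right hs (abs_nonneg _)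
    have h2 : Real.exp (κ * |W ω|) = Real.exp (κ / 2 * |W ω|) * Real.exp (κ / 2 * |W ω|) := by
      rw [← Real.exp_add]; congr 1; ring
    calc (s * W ω) ^ 2 * Real.exp |s * W ω|
        = s ^ 2 * (W ω ^ 2 * Real.exp |s * W ω|) := by ring
      _ ≤ s ^ 2 * (8 / κ ^ 2 * Real.exp (κ / 2 * |W ω|) * Real.exp (κ / 2 * |W ω|)) := by
          refine mul_le_mul_of_nonneg_left ?_ (sq_nonneg s)
          exact mul_le_mul (sq_le_mul_exp hκ _) h1 (Real.exp_pos _).le (by positivity)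
      _ = _ := by rw [h2]; ring
  have hint1 : Integrable (fun ω => 1 + s * W ω) μ :=
    (integrable_const 1).add (hWi.const_mul s)
  have hint2 : Integrable (fun ω => 8 / κ ^ 2 * s ^ 2 * Real.exp (κ * |W ω|)) μ :=
    hi.const_mul _
  have h := integral_mono (integrable_exp_mul_of_abs_le hW hi (hs.trans (by linarith)))
    (hint1.add hint2) hle
  simp only [Pi.add_apply] at h
  rw [integral_add hint1 hint2, integral_add (integrable_const 1) (hWi.const_mul s),
    integral_const_mul, integral_const_mul] at h
  simp only [integral_const, probReal_univ, smul_eq_mul, mul_one] at h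
  rw [mgf]
  refine h.trans ?_
  have h4 : 8 / κ ^ 2 * s ^ 2 * ∫ ω, Real.exp (κ * |W ω|) ∂μ ≤ 24 / κ ^ 2 * s ^ 2 := by
    calc _ ≤ 8 / κ ^ 2 * s ^ 2 * 3 := mul_le_mul_of_nonneg_left h3 (by positivity)
      _ = _ := by ring
  linarith [Real.add_one_le_exp (s * ∫ ω, W ω ∂μ + 24 / κ ^ 2 * s ^ 2)]

/-- Bernstein's inequality for the mean of independent copies of a variable with an exponential
moment. -/
theorem measureReal_lt_abs_mean_sub_le (hκ : 0 < κ) {n : ℕ} (hn : 0 < n) {Ws : Fin n → Ω → ℝ}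
    (hind : iIndepFun Ws μ) (hid : ∀ i, IdentDistrib (Ws i) W μ μ)
    (hi : Integrable (fun ω => Real.exp (κ * |W ω|)) μ)
    (h3 : ∫ ω, Real.exp (κ * |W ω|) ∂μ ≤ 3) {t : ℝ} (ht : 0 ≤ t) (ht' : t ≤ 24 / κ) :
    μ.real {ω | t < |(n : ℝ)⁻¹ * ∑ i, Ws i ω - ∫ ω, W ω ∂μ|} ≤
      2 * Real.exp (-(n * t ^ 2 * κ ^ 2 / 96)) := by
  have hW : AEMeasurable W μ := (hid ⟨0, hn⟩).aemeasurable_snd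
  have hn' : (0 : ℝ) < n := by exact_mod_cast hn
  set m := ∫ ω, W ω ∂μ
  have hsum : ∀ s : ℝ, mgf (∑ i, Ws i) μ s = mgf W μ s ^ n := fun s => by
    rw [hind.mgf_sum₀ (fun i => (hid i).aemeasurable_fst)]
    simp [fun i => mgf_congr_identDistrib (hid i)]
  have hmgf : ∀ s : ℝ, |s| ≤ κ / 2 → Integrable (fun ω => Real.exp (s * (∑ i, Ws i) ω)) μ ∧
      mgf (∑ i, Ws i) μ s ≤ Real.exp (n * (s * m + 24 / κ ^ 2 * s ^ 2)) := by
    intro s hs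
    have hpos : 0 < mgf W μ s :=
      mgf_pos (integrable_exp_mul_of_abs_le hW hi (hs.trans (by linarith)))
    refine ⟨?_, ?_⟩
    -- A non-integrable exponential would have `mgf` equal to 0 by default, but it is a power of a
    -- positive number.
    · by_contra hni
      have := mgf_undef hni
      rw [hsum] at this
      exact (pow_pos hpos n).ne' this
    · rw [hsum, Real.exp_nat_mul]
      exact pow_le_pow_left₀ hpos.le (mgf_le_exp_of_integral_exp_abs_le hκ hW hi h3 hs) n
  -- The minimizer of -st + 24s²/κ²; the condition `t ≤ 24 / κ` is exactly `s ≤ κ / 2`.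
  set s := t * κ ^ 2 / 48 with hs
  have hs0 : 0 ≤ s := by positivity
  have hs2 : |s| ≤ κ / 2 := by
    rw [abs_of_nonneg hs0, hs, div_le_iff₀ (by norm_num)]
    rw [le_div_iff₀ hκ] at ht'
    nlinarith
  have hexp : n * (-(s * t) + 24 / κ ^ 2 * s ^ 2) = -(n * t ^ 2 * κ ^ 2 / 96) := by
    rw [hs]; field_simp; ring
  have hup : μ.real {ω | n * (m + t) ≤ (∑ i, Ws i) ω} ≤
      Real.exp (-(n * t ^ 2 * κ ^ 2 / 96)) := by
    obtain ⟨h1, h2⟩ := hmgf s hs2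
    refine (measure_ge_le_exp_mul_mgf _ hs0 h1).trans ?_
    refine (mul_le_mul_of_nonneg_left h2 (Real.exp_pos _).le).trans_eq ?_
    rw [← Real.exp_add, ← hexp]
    congr 1; ring
  have hlow : μ.real {ω | (∑ i, Ws i) ω ≤ n * (m - t)} ≤
      Real.exp (-(n * t ^ 2 * κ ^ 2 / 96)) := by
    obtain ⟨h1, h2⟩ := hmgf (-s) (by rwa [abs_neg])
    refine (measure_le_le_exp_mul_mgf _ (by linarith) h1).trans ?_
    refine (mul_le_mul_of_nonneg_left h2 (Real.exp_pos _).le).trans_eq ?_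
    rw [← Real.exp_add, ← hexp]
    congr 1; ring
  have hsub : {ω | t < |(n : ℝ)⁻¹ * ∑ i, Ws i ω - m|} ⊆
      {ω | n * (m + t) ≤ (∑ i, Ws i) ω} ∪ {ω | (∑ i, Ws i) ω ≤ n * (m - t)} := by
    intro ω hω
    simp only [Set.mem_ofPred_eq, Set.mem_union, Finset.sum_apply] at hω ⊢
    rw [← div_eq_inv_mul] at hω
    rcases lt_abs.1 hω with h | h
    · left
      have : m + t ≤ (∑ i, Ws i ω) / n := by linarith
      rw [le_div_iff₀ hn'] at this
      linarith
    · right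
      have : (∑ i, Ws i ω) / n ≤ m - t := by linarith
      rw [div_le_iff₀ hn'] at this
      linarith
  refine (measureReal_mono hsub).trans ((measureReal_union_le _ _).trans ?_)
  linarith

end ExpMoment

end Concentration

/-! ### Population and sample covariances -/

theorem norm_toEuclideanLin_le_of_bilin {k l : ℕ} {A : Matrix (Fin k) (Fin l) ℝ} {L : ℝ}
    (hL : 0 ≤ L) (h : ∀ a b, ‖a‖ = 1 → ‖b‖ = 1 → |bilin A a b| ≤ L) (w : Vec l) :
    ‖toEuclideanLin A w‖ ≤ L * ‖w‖ := by
  rcases eq_or_ne w 0 with rfl | hw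
  · simp
  rcases eq_or_ne (toEuclideanLin A w) 0 with h0 | h0
  · rw [h0, norm_zero]
    positivity
  have hw' := norm_pos_iff.2 hw
  have h0' := norm_pos_iff.2 h0
  have h1 := h (‖toEuclideanLin A w‖⁻¹ • toEuclideanLin A w) (‖w‖⁻¹ • w)
    (by rw [norm_smul, norm_inv, norm_norm, inv_mul_cancel₀ h0'.ne'])
    (by rw [norm_smul, norm_inv, norm_norm, inv_mul_cancel₀ hw'.ne'])
  rw [bilin_eq_inner, map_smul, real_inner_smul_left, real_inner_smul_right,
    real_inner_self_eq_norm_sq] at h1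
  have h2 : ‖toEuclideanLin A w‖⁻¹ * (‖w‖⁻¹ * ‖toEuclideanLin A w‖ ^ 2) =
      ‖toEuclideanLin A w‖ / ‖w‖ := by
    field_simp
  rw [h2] at h1
  exact (div_le_iff₀ hw').1 ((le_abs_self _).trans h1)

section Covariance

variable {Ω : Type*} [MeasurableSpace Ω] {μ : Measure Ω}

theorem measurable_dotProduct {k : ℕ} (a : Vec k) :
    Measurable fun x : Vec k => a.ofLp ⬝ᵥ x.ofLp := by
  unfold dotProduct
  fun_prop

theorem covMatrix_apply_of_hasMeanZero {k l : ℕ} {V : Ω → Vec k} {W : Ω → Vec l}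
    (hV : HasMeanZero μ V) (hW : HasMeanZero μ W) (i : Fin k) (j : Fin l) :
    covMatrix μ V W i j = ∫ ω, V ω i * W ω j ∂μ := by
  simp [covMatrix, covariance, (hV i).2, (hW j).2]

theorem bilin_covMatrix {k l : ℕ} {V : Ω → Vec k} {W : Ω → Vec l}
    (hV : HasMeanZero μ V) (hW : HasMeanZero μ W)
    (hVW : ∀ i j, Integrable (fun ω => V ω i * W ω j) μ) (a : Vec k) (b : Vec l) :
    bilin (covMatrix μ V W) a b =
      ∫ ω, (a.ofLp ⬝ᵥ (V ω).ofLp) * (b.ofLp ⬝ᵥ (W ω).ofLp) ∂μ := by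
  have h : ∀ ω, (a.ofLp ⬝ᵥ (V ω).ofLp) * (b.ofLp ⬝ᵥ (W ω).ofLp) =
      ∑ i, ∑ j, a i * b j * (V ω i * W ω j) := fun ω => by
    rw [dotProduct, dotProduct, Finset.sum_mul_sum]
    exact Finset.sum_congr rfl fun i _ => Finset.sum_congr rfl fun j _ => by ring
  simp_rw [h]
  rw [integral_finsetSum _ fun i _ => integrable_finsetSum _ fun j _ => (hVW i j).const_mul _]
  rw [bilin, dotProduct]
  refine Finset.sum_congr rfl fun i _ => ?_
  rw [integral_finsetSum _ fun j _ => (hVW i j).const_mul _, mulVec, dotProduct, Finset.mul_sum]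
  refine Finset.sum_congr rfl fun j _ => ?_
  rw [integral_const_mul, covMatrix_apply_of_hasMeanZero hV hW]
  ring

/-- All linear forms with unit coefficient vectors satisfy the tail bound. -/
def IsSubGaussianVec {k : ℕ} (μ : Measure Ω) (V : Ω → Vec k) (σ : ℝ) : Prop :=
  ∀ a : Vec k, ‖a‖ = 1 → HasTailBound μ (fun ω => a.ofLp ⬝ᵥ (V ω).ofLp) σ

theorem IsJointSubGaussian.left {p r : ℕ} {X : Ω → Vec p} {Y : Ω → Vec r} {σ : ℝ}
    (h : IsJointSubGaussian μ X Y σ) : IsSubGaussianVec μ X σ := by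
  intro a ha t ht
  simpa using h a 0 (by simp [ha]) t ht

theorem IsJointSubGaussian.right {p r : ℕ} {X : Ω → Vec p} {Y : Ω → Vec r} {σ : ℝ}
    (h : IsJointSubGaussian μ X Y σ) : IsSubGaussianVec μ Y σ := by
  intro a ha t ht
  simpa using h 0 a (by simp [ha]) t ht

theorem IsSubGaussianVec.coord {k : ℕ} {V : Ω → Vec k} {σ : ℝ} (h : IsSubGaussianVec μ V σ)
    (i : Fin k) : HasTailBound μ (fun ω => V ω i) σ := by
  have := h (EuclideanSpace.single i 1) (by simp)
  simpa using this

variable [IsProbabilityMeasure μ] {k l : ℕ} {V : Ω → Vec k} {W : Ω → Vec l} {σ : ℝ}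

theorem integrable_coord_mul_coord (hσ : 0 < σ) (hV : Measurable V) (hW : Measurable W)
    (hV' : IsSubGaussianVec μ V σ) (hW' : IsSubGaussianVec μ W σ) (i : Fin k) (j : Fin l) :
    Integrable (fun ω => V ω i * W ω j) μ := by
  have hVi : Measurable fun ω => V ω i := by fun_prop
  have hWj : Measurable fun ω => W ω j := by fun_prop
  exact integrable_of_integrable_exp_abs (by positivity) (hVi.mul hWj).aemeasurable
    ((hV'.coord i).integral_exp_mul_le hσ hVi.aemeasurable hWj.aemeasurable (hW'.coord j)).1

/-- A first moment is at most 3/κ with κ = 1/(2σ²). The bound 6σ² is free of the dimension, so the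
covariance operators are bounded uniformly in `n`. -/
theorem abs_bilin_covMatrix_le (hσ : 0 < σ) (hV : Measurable V) (hW : Measurable W)
    (hV0 : HasMeanZero μ V) (hW0 : HasMeanZero μ W)
    (hV' : IsSubGaussianVec μ V σ) (hW' : IsSubGaussianVec μ W σ) (a : Vec k) (b : Vec l)
    (ha : ‖a‖ = 1) (hb : ‖b‖ = 1) : |bilin (covMatrix μ V W) a b| ≤ 6 * σ ^ 2 := by
  rw [bilin_covMatrix hV0 hW0 (integrable_coord_mul_coord hσ hV hW hV' hW')]
  obtain ⟨h1, h2⟩ := (hV' a ha).integral_exp_mul_le hσ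
    ((measurable_dotProduct a).comp hV).aemeasurable
    ((measurable_dotProduct b).comp hW).aemeasurable (hW' b hb)
  refine (abs_integral_le_of_integral_exp_abs_le (by positivity) h1 h2).trans_eq ?_
  field_simp
  norm_num

theorem norm_covMatrix_le (hσ : 0 < σ) (hV : Measurable V) (hW : Measurable W)
    (hV0 : HasMeanZero μ V) (hW0 : HasMeanZero μ W)
    (hV' : IsSubGaussianVec μ V σ) (hW' : IsSubGaussianVec μ W σ) (w : Vec l) :
    ‖toEuclideanLin (covMatrix μ V W) w‖ ≤ 6 * σ ^ 2 * ‖w‖ :=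
  norm_toEuclideanLin_le_of_bilin (by positivity)
    (abs_bilin_covMatrix_le hσ hV hW hV0 hW0 hV' hW') w

theorem quadForm_popM_nonneg (hσ : 0 < σ) (hV : Measurable V) (hV0 : HasMeanZero μ V)
    (hV' : IsSubGaussianVec μ V σ) (w : Vec k) : 0 ≤ quadForm (popM μ V) w := by
  have h := bilin_covMatrix hV0 hV0 (integrable_coord_mul_coord hσ hV hV hV' hV') w w
  rw [popM, show quadForm (covMatrix μ V V) w = bilin (covMatrix μ V V) w w from rfl, h]
  exact integral_nonneg fun ω => mul_self_nonneg _

theorem quadForm_popM_le (hσ : 0 < σ) (hV : Measurable V) (hV0 : HasMeanZero μ V)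
    (hV' : IsSubGaussianVec μ V σ) (w : Vec k) :
    quadForm (popM μ V) w ≤ 6 * σ ^ 2 * ‖w‖ ^ 2 := by
  rw [quadForm_eq_inner]
  refine (real_inner_le_norm _ _).trans ?_
  have := mul_le_mul_of_nonneg_left (norm_covMatrix_le hσ hV hV hV0 hV0 hV' hV' w) (norm_nonneg w)
  rw [popM]
  linarith

end Covariance

/-! ### Entrywise concentration of the sample covariance matrices. -/

section Sample

variable {Ω : Type*} [MeasurableSpace Ω] {μ : Measure Ω} [IsProbabilityMeasure μ]
  {n p r : ℕ} {X : Ω → Vec p} {Y : Ω → Vec r} {Xs : Fin n → Ω → Vec p} {Ys : Fin n → Ω → Vec r}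
  {σ : ℝ}

/-- Bernstein's inequality with κ = 1/(2σ²), for which 24/κ = 48σ² and κ²/96 = 1/(384σ⁴). -/
theorem measureReal_lt_abs_sampleMean_mul_le (hσ : 0 < σ) (hX : Measurable X)
    (hY : Measurable Y) (hiid : IsIIDSample μ X Y Xs Ys) (hn : 0 < n)
    {f g : Vec p × Vec r → ℝ} (hf : Measurable f) (hg : Measurable g)
    (hf' : HasTailBound μ (fun ω => f (X ω, Y ω)) σ)
    (hg' : HasTailBound μ (fun ω => g (X ω, Y ω)) σ) {t : ℝ} (ht : 0 ≤ t)
    (ht' : t ≤ 48 * σ ^ 2) :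
    μ.real {ω | t < |(n : ℝ)⁻¹ * ∑ i, f (Xs i ω, Ys i ω) * g (Xs i ω, Ys i ω) -
      ∫ ω, f (X ω, Y ω) * g (X ω, Y ω) ∂μ|} ≤
      2 * Real.exp (-(n * t ^ 2 / (384 * σ ^ 4))) := by
  have hXY : Measurable fun ω => (X ω, Y ω) := hX.prodMk hY
  obtain ⟨h1, h2⟩ := hf'.integral_exp_mul_le hσ (hf.comp hXY).aemeasurable
    (hg.comp hXY).aemeasurable hg'
  have h := measureReal_lt_abs_mean_sub_le (μ := μ) (W := fun ω => f (X ω, Y ω) * g (X ω, Y ω))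
    (Ws := fun i ω => f (Xs i ω, Ys i ω) * g (Xs i ω, Ys i ω)) (by positivity) hn
    (hiid.indep.comp (fun _ x => f x * g x) fun _ => hf.mul hg)
    (fun i => (hiid.ident i).comp (hf.mul hg)) h1 h2 ht
    (by refine ht'.trans_eq ?_; field_simp; norm_num)
  refine h.trans_eq ?_
  congr 3
  field_simp
  ring

theorem sampleCov_apply {k l : ℕ} (x : Fin n → Vec k) (y : Fin n → Vec l) (i : Fin k)
    (j : Fin l) : sampleCov x y i j = (n : ℝ)⁻¹ * ∑ m, x m i * y m j := by
  simp [sampleCov, dataMatrix, Matrix.mul_apply]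

/-- With high probability the entries of the sample covariance matrices are close to those of
the population covariance matrices. -/
theorem measureReal_sampleCov_error_le (hσ : 0 < σ) (hX : Measurable X)
    (hY : Measurable Y) (hX0 : HasMeanZero μ X) (hY0 : HasMeanZero μ Y)
    (hsub : IsJointSubGaussian μ X Y σ) (hiid : IsIIDSample μ X Y Xs Ys) (hn : 0 < n)
    {t : ℝ} (ht : 0 ≤ t) (ht' : t ≤ 48 * σ ^ 2) :
    μ.real {ω | ¬((∀ i j, |(sampleCov (fun i => Ys i ω) (fun i => Ys i ω) - popM μ Y) i j| ≤ t) ∧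
      ∀ i j, |(sampleCov (fun i => Xs i ω) (fun i => Ys i ω) - covMatrix μ X Y) i j| ≤ t)} ≤
      (r * r + p * r) * (2 * Real.exp (-(n * t ^ 2 / (384 * σ ^ 4)))) := by
  set c := 2 * Real.exp (-(n * t ^ 2 / (384 * σ ^ 4)))
  set S : Fin r × Fin r → Set Ω := fun q =>
    {ω | t < |(sampleCov (fun i => Ys i ω) (fun i => Ys i ω) - popM μ Y) q.1 q.2|}
  set T : Fin p × Fin r → Set Ω := fun q =>
    {ω | t < |(sampleCov (fun i => Xs i ω) (fun i => Ys i ω) - covMatrix μ X Y) q.1 q.2|}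
  have hsubset : {ω | ¬((∀ i j,
      |(sampleCov (fun i => Ys i ω) (fun i => Ys i ω) - popM μ Y) i j| ≤ t) ∧
      ∀ i j, |(sampleCov (fun i => Xs i ω) (fun i => Ys i ω) - covMatrix μ X Y) i j| ≤ t)} ⊆
      (⋃ q, S q) ∪ ⋃ q, T q := by
    intro ω hω
    simp only [Set.mem_ofPred_eq, not_and_or, not_forall, not_le] at hω
    rcases hω with ⟨i, j, h⟩ | ⟨i, j, h⟩
    · exact Or.inl (Set.mem_iUnion.2 ⟨(i, j), h⟩)
    · exact Or.inr (Set.mem_iUnion.2 ⟨(i, j), h⟩)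
  have hS : ∀ q, μ.real (S q) ≤ c := by
    rintro ⟨i, j⟩
    have h := measureReal_lt_abs_sampleMean_mul_le hσ hX hY hiid hn
      (f := fun z => z.2 i) (g := fun z => z.2 j) (by fun_prop) (by fun_prop)
      (hsub.right.coord i) (hsub.right.coord j) ht ht'
    simpa only [S, Matrix.sub_apply, sampleCov_apply, popM,
      covMatrix_apply_of_hasMeanZero hY0 hY0] using h
  have hT : ∀ q, μ.real (T q) ≤ c := by
    rintro ⟨i, j⟩
    have h := measureReal_lt_abs_sampleMean_mul_le hσ hX hY hiid hn
      (f := fun z => z.1 i) (g := fun z => z.2 j) (by fun_prop) (by fun_prop)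
      (hsub.left.coord i) (hsub.right.coord j) ht ht'
    simpa only [T, Matrix.sub_apply, sampleCov_apply,
      covMatrix_apply_of_hasMeanZero hX0 hY0] using h
  refine (measureReal_mono hsubset).trans ((measureReal_union_le _ _).trans ?_)
  have h1 := (measureReal_iUnion_fintype_le (μ := μ) S).trans
    (Finset.sum_le_card_nsmul _ _ c fun q _ => hS q)
  have h2 := (measureReal_iUnion_fintype_le (μ := μ) T).trans
    (Finset.sum_le_card_nsmul _ _ c fun q _ => hT q)
  rw [nsmul_eq_mul] at h1 h2
  simp only [Finset.card_univ, Fintype.card_prod, Fintype.card_fin, Nat.cast_mul] at h1 h2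
  linarith

end Sample

/-! ### Consistency -/

/-- The estimation error on the event that the sample covariance matrices are close to those of
the population, in terms of the distribution of `(X, Y)`. -/
theorem exists_frobNorm_responseEnvelope_bound {σ δ : ℝ} (hσ : 0 < σ) (hδ : 0 < δ) (p d : ℕ) :
    ∃ C : ℝ, 0 ≤ C ∧ ∀ {Ω : Type*} [MeasurableSpace Ω] (μ : Measure Ω) [IsProbabilityMeasure μ]
      (n r u : ℕ) (X : Ω → Vec p) (Y : Ω → Vec r) (x : Fin n → Vec p) (y : Fin n → Vec r)
      (v : Fin d → Vec r) (τ t : ℝ) (E : Submodule ℝ (Vec r)),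
      Measurable X → Measurable Y → HasMeanZero μ X → HasMeanZero μ Y →
      IsJointSubGaussian μ X Y σ → 0 ≤ t → t ≤ 1 →
      IsLeadingEigenvectors (popM μ Y) v → δ ≤ eigenGap (popM μ Y) d →
      responseEnvelope μ X Y ≤ Submodule.span ℝ (Set.range v) →
      Module.finrank ℝ (responseEnvelope μ X Y) = u → 1 ≤ u →
      (∀ j, l1Norm (v j) ≤ τ) → (∀ i j, |(sampleCov y y - popM μ Y) i j| ≤ t) →
      (∀ i j, |(sampleCov x y - covMatrix μ X Y) i j| ≤ t) →
      C * (τ ^ 2 * t) < 1 → C * (τ ^ 2 * t) < scoreGap (popU μ X Y) v u →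
      IsSparseNIECE x y d u τ E →
      frobNorm (projMatrix E - projMatrix (responseEnvelope μ X Y)) ^ 2 ≤ C * (τ ^ 2 * t) := by
  obtain ⟨C, hC, h⟩ := exists_frobNorm_error_bound (L := 6 * σ ^ 2) (by positivity) hδ p d
  refine ⟨C, hC, ?_⟩
  intro Ω _ μ _ n r u X Y x y v τ t E hX hY hX0 hY0 hsub ht ht1 hv hgap henv hu hu1 hτ hSM hSB
    hsmall hgapU hE
  have hT : (covMatrix μ Y X)ᵀ = covMatrix μ X Y := by
    ext i j
    simp [covMatrix, covariance_comm]
  refine h n r u x y (popM μ Y) (covMatrix μ Y X) v τ t E ht ht1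
    (covMatrix_self_isHermitian μ Y) (quadForm_popM_nonneg hσ hY hY0 hsub.right)
    (quadForm_popM_le hσ hY hY0 hsub.right) ?_ hv hgap henv hu hu1 hτ hSM ?_ hsmall ?_ hE
  · rw [hT]
    exact norm_covMatrix_le hσ hX hY hX0 hY0 hsub.left hsub.right
  · rwa [hT]
  · rwa [hT]

/-- Needed to extract information from the rate condition: at a zero gap the inverse would be 0 by
convention. -/
theorem scoreGap_popU_pos {Ω : Type*} [MeasurableSpace Ω] {μ : Measure Ω}
    [IsProbabilityMeasure μ] {p r d u : ℕ} {X : Ω → Vec p} {Y : Ω → Vec r} {σ δ : ℝ}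
    (hσ : 0 < σ) (hδ : 0 < δ) (hY : Measurable Y) (hY0 : HasMeanZero μ Y)
    (hsub : IsJointSubGaussian μ X Y σ) {v : Fin d → Vec r}
    (hv : IsLeadingEigenvectors (popM μ Y) v) (hgap : δ ≤ eigenGap (popM μ Y) d)
    (henv : responseEnvelope μ X Y ≤ Submodule.span ℝ (Set.range v))
    (hu : Module.finrank ℝ (responseEnvelope μ X Y) = u) (hu1 : 1 ≤ u) :
    0 < scoreGap (popU μ X Y) v u := by
  have hT : (covMatrix μ Y X)ᵀ = covMatrix μ X Y := by
    ext i j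
    simp [covMatrix, covariance_comm]
  have h := (scoreGap_pos_and_le (covMatrix_self_isHermitian μ Y)
    (quadForm_popM_nonneg hσ hY hY0 hsub.right) hδ hgap hv henv hu hu1).1
  rwa [hT] at h

theorem tendsto_sqrt_log_div {r : ℕ → ℕ}
    (hlog : (fun n => Real.log (r n)) =o[atTop] (fun n => (n : ℝ))) :
    Tendsto (fun n : ℕ => √(Real.log (r n)) / √(n : ℝ)) atTop (𝓝 0) := by
  have h := hlog.tendsto_div_nhds_zero
  have h2 := (Real.continuous_sqrt.tendsto 0).comp h
  rw [Real.sqrt_zero] at h2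
  refine h2.congr fun n => ?_
  simp only [Function.comp]
  exact Real.sqrt_div (Real.log_natCast_nonneg _) _

/-- The rate condition makes the error bound small compared with any positive number and with
the score gap. -/
theorem eventually_mul_rate_lt {r : ℕ → ℕ} {τ Δ : ℕ → ℝ} (hΔ : ∀ n, 0 < Δ n)
    (hrate : (fun n => max (τ n ^ 2 * √(Real.log (r n)))
      ((Δ n ^ 2)⁻¹ * τ n ^ 2 * √(Real.log (r n)))) =o[atTop] (fun n : ℕ => √(n : ℝ)))
    {K : ℝ} (hK : 0 ≤ K) {ρ : ℝ} (hρ : 0 < ρ) :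
    ∀ᶠ n in atTop, K * (τ n ^ 2 * (√(Real.log (r n)) / √(n : ℝ))) < ρ ∧
      K * (τ n ^ 2 * (√(Real.log (r n)) / √(n : ℝ))) < Δ n := by
  have h1 := hrate.tendsto_div_nhds_zero.const_mul K
  rw [mul_zero] at h1
  filter_upwards [h1.eventually_lt_const hρ, h1.eventually_lt_const one_pos] with n h2 h3
  set a := K * (τ n ^ 2 * (√(Real.log (r n)) / √(n : ℝ))) with ha
  have hle : a ≤ K * (max (τ n ^ 2 * √(Real.log (r n)))
      ((Δ n ^ 2)⁻¹ * τ n ^ 2 * √(Real.log (r n))) / √(n : ℝ)) := by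
    rw [ha, ← mul_div_assoc]
    exact mul_le_mul_of_nonneg_left
      (div_le_div_of_nonneg_right (le_max_left _ _) (Real.sqrt_nonneg _)) hK
  have hle' : (Δ n ^ 2)⁻¹ * a ≤ K * (max (τ n ^ 2 * √(Real.log (r n)))
      ((Δ n ^ 2)⁻¹ * τ n ^ 2 * √(Real.log (r n))) / √(n : ℝ)) := by
    have : (Δ n ^ 2)⁻¹ * a =
        K * ((Δ n ^ 2)⁻¹ * τ n ^ 2 * √(Real.log (r n)) / √(n : ℝ)) := by
      rw [ha]; ring
    rw [this]
    exact mul_le_mul_of_nonneg_left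
      (div_le_div_of_nonneg_right (le_max_right _ _) (Real.sqrt_nonneg _)) hK
  refine ⟨hle.trans_lt h2, ?_⟩
  have h4 : a < 1 := hle.trans_lt h3
  have h5 : a < Δ n ^ 2 := by
    have := hle'.trans_lt h3
    rwa [inv_mul_lt_iff₀ (by have := hΔ n; positivity), mul_one] at this
  -- Both a < 1 and a < Δ² hold, and min(1, Δ²) ≤ Δ for positive Δ.
  rcases le_total 1 (Δ n) with h6 | h6
  · linarith
  · nlinarith [hΔ n]

/-- The factor 48σ² makes the exponent 6 log r, since 48²/384 = 6; the resulting r⁻⁶ beats the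
number of entries, of order r². -/
theorem union_bound_le {p r : ℕ} {n : ℕ} {σ : ℝ} (hσ : 0 < σ) (hn : 0 < n) (hr : 0 < r) :
    ((r : ℝ) * r + p * r) *
      (2 * Real.exp (-(n * (48 * σ ^ 2 * (√(Real.log r) / √(n : ℝ))) ^ 2 / (384 * σ ^ 4)))) ≤
      2 * (1 + p) / r := by
  have hn' : (0 : ℝ) < n := by exact_mod_cast hn
  have hr1 : (1 : ℝ) ≤ r := by exact_mod_cast hr
  have hr' : (0 : ℝ) < r := by linarith
  have h1 : n * (48 * σ ^ 2 * (√(Real.log r) / √(n : ℝ))) ^ 2 / (384 * σ ^ 4) =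
      6 * Real.log r := by
    rw [mul_pow, div_pow, Real.sq_sqrt (Real.log_natCast_nonneg _), Real.sq_sqrt hn'.le]
    field_simp
    ring
  have h2 : Real.exp (-(6 * Real.log r)) = ((r : ℝ) ^ 6)⁻¹ := by
    rw [Real.exp_neg, ← Real.exp_log (pow_pos hr' 6), Real.log_pow]
    norm_num
  rw [h1, h2, le_div_iff₀ hr']
  have h3 : (r : ℝ) * r + p * r ≤ (1 + p) * r ^ 2 := by
    have : (r : ℝ) ≤ r ^ 2 := by nlinarith
    nlinarith [mul_le_mul_of_nonneg_left this (Nat.cast_nonneg p : (0 : ℝ) ≤ p)]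
  have h4 : (r : ℝ) ^ 3 ≤ r ^ 6 := pow_le_pow_right₀ hr1 (by norm_num)
  have h5 : (r : ℝ) ^ 3 * ((r : ℝ) ^ 6)⁻¹ ≤ 1 := by
    rw [← div_eq_mul_inv]
    exact div_le_one_of_le₀ h4 (by positivity)
  have h6 : (0 : ℝ) ≤ ((r : ℝ) ^ 6)⁻¹ := by positivity
  have h7 : (0 : ℝ) ≤ 1 + p := by positivity
  calc ((r : ℝ) * r + p * r) * (2 * ((r : ℝ) ^ 6)⁻¹) * r
      ≤ ((1 + p) * r ^ 2) * (2 * ((r : ℝ) ^ 6)⁻¹) * r := by gcongr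
    _ = 2 * (1 + p) * ((r : ℝ) ^ 3 * ((r : ℝ) ^ 6)⁻¹) := by ring
    _ ≤ 2 * (1 + p) * 1 := by gcongr
    _ = 2 * (1 + p) := by ring

end SparseNIECE

end

theorem corollary3
    -- fixed numbers of predictors and of principal components; the number of responses,
    -- the envelope dimension and the tuning parameter may vary with the sample size `n`
    (p d : ℕ) (r u : ℕ → ℕ) (τ : ℕ → ℝ) (σ δ : ℝ) (hσ : 0 < σ) (hδ : 0 < δ)
    -- for each `n`, the population `(X, Y)` and a sample of size `n`
    (Ω : ℕ → Type*) [∀ n, MeasurableSpace (Ω n)]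
    (μ : ∀ n, Measure (Ω n)) [∀ n, IsProbabilityMeasure (μ n)]
    (X : ∀ n, Ω n → SparseNIECE.Vec p) (Y : ∀ n, Ω n → SparseNIECE.Vec (r n))
    (Xs : ∀ n, Fin n → Ω n → SparseNIECE.Vec p)
    (Ys : ∀ n, Fin n → Ω n → SparseNIECE.Vec (r n))
    (hX : ∀ n, Measurable (X n)) (hY : ∀ n, Measurable (Y n))
    (hlin : ∀ n, SparseNIECE.IsLinearModel (μ n) (X n) (Y n))
    (hX0 : ∀ n, SparseNIECE.HasMeanZero (μ n) (X n))
    (hY0 : ∀ n, SparseNIECE.HasMeanZero (μ n) (Y n))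
    (hsub : ∀ n, SparseNIECE.IsJointSubGaussian (μ n) (X n) (Y n) σ)
    (hiid : ∀ n, SparseNIECE.IsIIDSample (μ n) (X n) (Y n) (Xs n) (Ys n))
    -- the leading eigenvectors of `Σ_Y`, their eigen-gap, and the envelope
    (v : ∀ n, Fin d → SparseNIECE.Vec (r n))
    (hv : ∀ n, SparseNIECE.IsLeadingEigenvectors (SparseNIECE.popM (μ n) (Y n)) (v n))
    (hgap : ∀ n, δ ≤ SparseNIECE.eigenGap (SparseNIECE.popM (μ n) (Y n)) d)
    (henv : ∀ n, SparseNIECE.responseEnvelope (μ n) (X n) (Y n) ≤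
      Submodule.span ℝ (Set.range (v n)))
    (hu : ∀ n, Module.finrank ℝ (SparseNIECE.responseEnvelope (μ n) (X n) (Y n)) = u n)
    (hu1 : ∀ n, 1 ≤ u n)
    (hτ : ∀ n j, SparseNIECE.l1Norm (v n j) < τ n)
    -- the asymptotic regime
    (hr : Tendsto r atTop atTop)
    (hlog : (fun n => Real.log (r n)) =o[atTop] (fun n => (n : ℝ)))
    (hrate : (fun n => max (τ n ^ 2 * √(Real.log (r n)))
        ((SparseNIECE.scoreGap (SparseNIECE.popU (μ n) (X n) (Y n)) (v n) (u n) ^ 2)⁻¹ *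
          τ n ^ 2 * √(Real.log (r n)))) =o[atTop] (fun n => √(n : ℝ)))
    -- any version of the estimator
    (Ehat : ∀ n, Ω n → Submodule ℝ (SparseNIECE.Vec (r n)))
    (hEhat : ∀ n ω, SparseNIECE.IsSparseNIECE (fun i => Xs n i ω) (fun i => Ys n i ω)
      d (u n) (τ n) (Ehat n ω)) :
    ∀ η : ℝ, 0 < η →
      Tendsto (fun n => μ n {ω | η ≤ SparseNIECE.frobNorm
          (SparseNIECE.projMatrix (Ehat n ω) -
            SparseNIECE.projMatrix (SparseNIECE.responseEnvelope (μ n) (X n) (Y n)))})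
        atTop (𝓝 0) := by
  intro η hη
  obtain ⟨C, hC, hbound⟩ := SparseNIECE.exists_frobNorm_responseEnvelope_bound hσ hδ p d
  have hΔ : ∀ n, 0 < SparseNIECE.scoreGap (SparseNIECE.popU (μ n) (X n) (Y n)) (v n) (u n) :=
    fun n => SparseNIECE.scoreGap_popU_pos hσ hδ (hY n) (hY0 n) (hsub n) (hv n) (hgap n)
      (henv n) (hu n) (hu1 n)
  -- The entrywise noise level √(log r / n). With this constant, the requirement t ≤ 48σ² says that
  -- √(log r / n) is at most 1.
  set t : ℕ → ℝ := fun n => 48 * σ ^ 2 * (√(Real.log (r n)) / √(n : ℝ)) with ht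
  have ht0 : ∀ n, 0 ≤ t n := fun n => by positivity
  have hsmall := SparseNIECE.tendsto_sqrt_log_div hlog
  have ht1 : ∀ᶠ n in atTop, t n ≤ 1 := by
    have h := hsmall.const_mul (48 * σ ^ 2)
    rw [mul_zero] at h
    exact (h.eventually_lt_const one_pos).mono fun n hn => hn.le
  have hle : ∀ᶠ n in atTop, μ n {ω | η ≤ SparseNIECE.frobNorm
      (SparseNIECE.projMatrix (Ehat n ω) -
        SparseNIECE.projMatrix (SparseNIECE.responseEnvelope (μ n) (X n) (Y n)))} ≤
      ENNReal.ofReal (2 * (1 + p) / r n) := by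
    filter_upwards [ht1, hsmall.eventually_lt_const one_pos, eventually_gt_atTop 0,
      hr.eventually_gt_atTop 0,
      SparseNIECE.eventually_mul_rate_lt hΔ hrate (K := C * (48 * σ ^ 2)) (by positivity)
        -- The bound 1 is the smallness condition of the deterministic estimate; `η ^ 2` appears
        -- because that estimate controls the squared distance.
        (lt_min one_pos (pow_pos hη 2))] with n htn hsn hn hrn hKn
    have hrw : C * (48 * σ ^ 2) * (τ n ^ 2 * (√(Real.log (r n)) / √(n : ℝ))) =
        C * (τ n ^ 2 * t n) := by
      rw [ht]; ring
    rw [hrw] at hKn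
    obtain ⟨hK1, hKΔ⟩ := hKn
    have hevent := SparseNIECE.measureReal_sampleCov_error_le hσ (hX n) (hY n) (hX0 n) (hY0 n)
      (hsub n) (hiid n) hn (ht0 n)
      (mul_le_of_le_one_right (by positivity) hsn.le)
    refine le_trans (measure_mono fun ω hω => ?_) ((ENNReal.le_ofReal_iff_toReal_le
      (measure_ne_top _ _) (by positivity)).2
      (hevent.trans (SparseNIECE.union_bound_le hσ hn hrn)))
    simp only [Set.mem_ofPred_eq] at hω ⊢
    rintro ⟨hSM, hSB⟩
    have h := hbound (μ n) n (r n) (u n) (X n) (Y n) (fun i => Xs n i ω) (fun i => Ys n i ω)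
      (v n) (τ n) (t n) (Ehat n ω) (hX n) (hY n) (hX0 n) (hY0 n) (hsub n) (ht0 n) htn (hv n)
      (hgap n) (henv n) (hu n) (hu1 n) (fun j => (hτ n j).le) hSM hSB
      (hK1.trans_le (min_le_left _ _)) hKΔ (hEhat n ω)
    have h1 := h.trans_lt (hK1.trans_le (min_le_right _ _))
    exact absurd (pow_le_pow_left₀ hη.le hω 2) (not_le.2 h1)
  have hlim : Tendsto (fun n => ENNReal.ofReal (2 * (1 + p) / r n)) atTop (𝓝 0) := by
    rw [← ENNReal.ofReal_zero]
    exact ENNReal.tendsto_ofReal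
      (tendsto_const_nhds.div_atTop (tendsto_natCast_atTop_atTop.comp hr))
  exact tendsto_of_tendsto_of_tendsto_of_le_of_le' tendsto_const_nhds hlim
    (Eventually.of_forall fun _ => zero_le) hle
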